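/- Let $S^1=\mathbb{R}/\mathbb{Z}$ be the circle of unit circumference and let $\vec d(x,y)\in[0,1)$ denote the clockwise distance from $x$ to $y$. For a finite set $X\subseteq S^1$ and $0<r\le 1$, let $f_r\colon X\to X$ send $x$ to the element of $X\cap[x,x+r)_{S^1}=\{y\in X:\vec d(x,y)<r\}$ that is clockwise furthest from $x$. A point $x\in X$ is periodic if $f_r^m(x)=x$ for some $m\ge 1$; a non-periodic point $x$ is at level $i\ge 0$ if $x\in f_r^{i}(X)\setminus f_r^{i+1}(X)$. Let $\mathrm{lev}_i(X,r)$ be the number of non-periodic points at level $i$. Write the points of $\mathbb{R}_+^{2i+2}=[0,\infty)^{2i+2}$ as $u=(z_1,\ldots,z_{i+1},w_1,\ldots,w_{i+1})$, put $\|u\|_1=\sum_j z_j+\sum_j w_j$, let $H(j,k)$ denote the inequality $z_1+\cdots+z_j\ge w_1+\cdots+w_k$ (for $k=0$ the right-hand side is $0$) and $\neg H(j,k)$ its negation. Define the cones in $\mathbb{R}_+^{2i+2}$ $$K_i:\quad H(1,1),\,H(2,2),\,\ldots,\,H(i,i),\,\neg H(i+1,i+1);$$ $$K_i(q):\quad \text{the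 inequalities of } K_i \text{ together with } \neg H(1,q-1),\,\neg H(2,q),\,\ldots,\,\neg H(i-q+2,i)$$ (so $K_i(q)=K_i$ if $i\le q-2$). **Proposition 3.3.** Let $0<r\le 1$ and $i\ge 0$, and for each $n$ let $X_n\subseteq S^1$ be a sample of $n$ points chosen independently and uniformly at random from $S^1$. Then $\mathrm{lev}_i(X_n,r)$ has finite expectation for every $n$, and $$\lim_{n\to\infty}\frac{\mathbf{E}[\mathrm{lev}_i(X_n,r)]}{n}=\begin{cases}\displaystyle\int_{K_i}e^{-\|u\|_1}\,du & \text{if } r\notin\mathbb{Q},\\[2ex] \displaystyle\int_{K_i(q)}e^{-\|u\|_1}\,du & \text{if } r=\tfrac{p}{q} \text{ with } p,q \text{ relatively prime positive integers.}\end{cases}$$ -/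

import Mathlib

open MeasureTheory ProbabilityTheory Filter Topology
open scoped Classical

noncomputable section

/-- The clockwise distance from `x` to `y` on the circle `ℝ/ℤ`: the unique `d ∈ [0, 1)` with
`y = x + d` (the clockwise direction is the increasing direction of `ℝ/ℤ`). -/
def cwDist (x y : UnitAddCircle) : ℝ := (AddCircle.equivIco (1 : ℝ) 0 (y - x) : ℝ)

theorem cwDist_self (x : UnitAddCircle) : cwDist x x = 0 := by
  have h : (0 : ℝ) ∈ Set.Ico (0 : ℝ) (0 + 1) := by norm_num
  have h2 := AddCircle.equivIco_coe_eq (p := (1 : ℝ)) (a := 0) h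
  simp only [cwDist, sub_self]
  rw [show (0 : UnitAddCircle) = ((0 : ℝ) : UnitAddCircle) from rfl, h2]

/-- Among the points of the finite set `X` in the arc `[x, x + r)`, i.e. those at clockwise
distance less than `r` from `x`, there is one that is clockwise furthest from `x`. -/
theorem exists_furthest (X : Finset UnitAddCircle) (r : ℝ) (hr : 0 < r) (x : X) :
    ∃ y : X, cwDist x y < r ∧ ∀ y' : X, cwDist x y' < r → cwDist x y' ≤ cwDist x y := by
  obtain ⟨y, hy, hmax⟩ := Finset.exists_max_image
    (Finset.univ.filter (fun y : X => cwDist x y < r)) (fun y : X => cwDist x y)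
    ⟨x, by simpa [cwDist_self] using hr⟩
  exact ⟨y, by simpa using hy, fun y' h' => hmax y' (by simpa using h')⟩

/-- The map `f_r : X → X`, sending `x` to the element of `X ∩ [x, x + r)` that is clockwise
furthest from `x` (unique, since `cwDist x` is injective). -/
def cyclicMap (X : Finset UnitAddCircle) (r : ℝ) (hr : 0 < r) (x : X) : X :=
  Classical.choose (exists_furthest X r hr x)

/-- The number of non-periodic points of `f_r : X → X` at level `i`, i.e. lying in
`f_r^i(X) \ f_r^{i+1}(X)`. -/
def lev (X : Finset UnitAddCircle) (r : ℝ) (hr : 0 < r) (i : ℕ) : ℕ :=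
  Set.ncard {x : X | x ∉ Function.periodicPts (cyclicMap X r hr) ∧
    x ∈ Set.range (cyclicMap X r hr)^[i] ∧ x ∉ Set.range (cyclicMap X r hr)^[i + 1]}

/-- The finite set of points taken by a finite family of circle-valued random variables. -/
def sampleSet {Ω : Type*} {n : ℕ} (X : Fin n → Ω → UnitAddCircle) (ω : Ω) :
    Finset UnitAddCircle :=
  Finset.univ.image (fun k => X k ω)

/-- `ℝ^{2i+2}`, with coordinates labelled `z_1, …, z_{i+1}, w_1, …, w_{i+1}`: `z_j` is the
coordinate `Sum.inl (j - 1)` and `w_j` is the coordinate `Sum.inr (j - 1)`. -/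
abbrev GapSpace (i : ℕ) : Type := Fin (i + 1) ⊕ Fin (i + 1) → ℝ

/-- `z_1 + ⋯ + z_j`. -/
def zSum {i : ℕ} (u : GapSpace i) (j : ℕ) : ℝ :=
  ∑ a : Fin (i + 1) with a.val < j, u (Sum.inl a)

/-- `w_1 + ⋯ + w_k`. -/
def wSum {i : ℕ} (u : GapSpace i) (k : ℕ) : ℝ :=
  ∑ b : Fin (i + 1) with b.val < k, u (Sum.inr b)

/-- The inequality `H(j,k)`: `z_1 + ⋯ + z_j ≥ w_1 + ⋯ + w_k`. -/
def gapIneq {i : ℕ} (u : GapSpace i) (j k : ℕ) : Prop := zSum u j ≥ wSum u k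

/-- The cone `K_i`: `H(1,1), …, H(i,i), ¬H(i+1,i+1)` in the nonnegative orthant. -/
def coneK (i : ℕ) : Set (GapSpace i) :=
  {u | (∀ a, 0 ≤ u a) ∧ (∀ j, 1 ≤ j → j ≤ i → gapIneq u j j) ∧ ¬ gapIneq u (i + 1) (i + 1)}

/-- The cone `K_i(q)`: the inequalities of `K_i` and `¬H(1,q-1), ¬H(2,q), …, ¬H(i-q+2,i)`,
i.e. `¬H(j,k)` for all `j ≥ 1` and `k = j + q - 2 ≤ i`. -/
def coneKq (i q : ℕ) : Set (GapSpace i) :=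
  {u | u ∈ coneK i ∧ ∀ j k : ℕ, 1 ≤ j → j + q = k + 2 → k ≤ i → ¬ gapIneq u j k}

/-- The norm `‖u‖₁`. -/
def l1Norm {i : ℕ} (u : GapSpace i) : ℝ := ∑ a, |u a|

end

/-! ### Clockwise distance -/

/-! Fix `x ∈ X` and let T_k be `shiftSet X r x k`, the lift of `X` seen from `x - k r`. In these
coordinates `f_r` sends a point of T_{k+1} to its predecessor in T_k (`cyclicMap_shift`). Let A_0 =
B_0 = 0, let A_{k+1} be the successor of A_k in T_k and B_{k+1} the successor of B_k in T_{k+1}. An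
iterate of order k+1 started at s in T_{k+1} lands at or before `x` iff s ≤ A_{k+1}, and at or after
`x` iff s > B_k; so `x` lies in the image of that iterate iff B_{k+1} ≤ A_{k+1}. With A and B the
partial sums of the gaps z and w, this says that level i means the gap vector lies in K_i
(`level_iff_mem_coneK`).

When q r is an integer, T_{k+q} = T_k. This dependence forces the additional inequalities of K_i(q)
almost surely (`mem_coneKq_of_mem_coneK`). Conversely, those inequalities make the gaps pairwise
disjoint arcs once they are small (`gap_disjoint`, `smallCone.eq_of_mem`). The irrational case is
absorbed by taking q = i+2, for which K_i(q) = K_i.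

The points of level i with small gaps are therefore counted by the ways of labelling a base point
and 2i+2 gap endpoints among the n samples. The map from gaps to endpoints is unimodular, and each
remaining sample must avoid disjoint arcs of total length ‖u‖, so each labelling has probability ∫
(1-‖u‖)^{n-2i-3} over the small part of K_i(q) (`volume_markedEvent`). Summing over labellings and
rescaling u by 1/n gives the exponential integral in the limit
(`tendsto_descFactorial_mul_integral`). Samples with a large gap are exponentially rare
(`volume_sparseEvent_le`), so their contribution vanishes. -/

theorem coe_eq_coe_iff_sub_int {a b : ℝ} :
    (a : UnitAddCircle) = b ↔ ∃ m : ℤ, a - b = m := by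
  rw [← sub_eq_zero, ← AddCircle.coe_sub, AddCircle.coe_eq_zero_iff]
  simp [eq_comm]

theorem cwDist_add_coe (x : UnitAddCircle) (v : ℝ) : cwDist x (x + v) = Int.fract v := by
  simp [cwDist, AddCircle.coe_equivIco_mk_apply]

theorem add_cwDist (x y : UnitAddCircle) : x + (cwDist x y : ℝ) = y := by
  simp [cwDist, AddCircle.coe_equivIco]

theorem cwDist_nonneg (x y : UnitAddCircle) : 0 ≤ cwDist x y :=
  (AddCircle.equivIco (1 : ℝ) 0 (y - x)).2.1

theorem cwDist_lt_one (x y : UnitAddCircle) : cwDist x y < 1 :=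
  (AddCircle.equivIco (1 : ℝ) 0 (y - x)).2.2.trans_eq (zero_add 1)

theorem cwDist_injective (x : UnitAddCircle) : Function.Injective (cwDist x) := fun y z h => by
  rw [← add_cwDist x y, h, add_cwDist]

theorem cwDist_eq_of_mem {x y : UnitAddCircle} {v : ℝ} (h : y = x + v) (h0 : 0 ≤ v)
    (h1 : v < 1) : cwDist x y = v := by
  rw [h, cwDist_add_coe, Int.fract_eq_self.2 ⟨h0, h1⟩]

/-- The quantity `1 - cwDist y x` is the displacement from `x` to `y` normalised to (0, 1], so a
point counts as a full turn ahead of itself. This is the normalisation needed for strict successors.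
-/
theorem one_sub_cwDist_le_of_pos {x y : UnitAddCircle} {v : ℝ} (h : y = x + v) (h0 : 0 < v) :
    1 - cwDist y x ≤ v := by
  have h' : x = y + ((-v : ℝ) : UnitAddCircle) := by rw [h]; simp
  rw [h', cwDist_add_coe]
  have h2 := Int.fract_add_floor (-v)
  have h3 : ⌊-v⌋ ≤ -1 := by
    have : ⌊-v⌋ < 0 := Int.floor_lt.2 (by simpa using h0)
    omega
  have : (⌊-v⌋ : ℝ) ≤ -1 := by exact_mod_cast h3
  linarith

theorem eq_add_one_sub_cwDist (x y : UnitAddCircle) :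
    y = x + ((1 - cwDist y x : ℝ) : UnitAddCircle) := by
  have := add_cwDist y x
  have h1 : ((1 : ℝ) : UnitAddCircle) = 0 := AddCircle.coe_period 1
  rw [AddCircle.coe_sub, h1, zero_sub, ← sub_eq_add_neg, eq_sub_iff_add_eq, this]

theorem measurable_equivIco_coe :
    Measurable (fun y : UnitAddCircle => (AddCircle.equivIco (1 : ℝ) 0 y : ℝ)) :=
  measurable_subtype_coe.comp (AddCircle.measurableEquivIco (1 : ℝ) 0).measurable

theorem measurable_cwDist {α : Type*} [MeasurableSpace α] {f g : α → UnitAddCircle}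
    (hf : Measurable f) (hg : Measurable g) : Measurable (fun a => cwDist (f a) (g a)) :=
  measurable_equivIco_coe.comp (hg.sub hf)

theorem measurePreserving_cwDist (x : UnitAddCircle) :
    MeasurePreserving (cwDist x) volume (volume.restrict (Set.Ico (0 : ℝ) 1)) := by
  have h0 : MeasurePreserving (fun y : UnitAddCircle => (AddCircle.equivIco (1 : ℝ) 0 y : ℝ)) volume
      (volume.restrict (Set.Ico (0 : ℝ) 1)) := by
    refine ⟨measurable_equivIco_coe, ?_⟩
    have h1 := UnitAddCircle.measurePreserving_mk 0
    rw [← h1.map_eq, Measure.map_map measurable_equivIco_coe h1.measurable]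
    have h2 : (fun v : ℝ => v) =ᵐ[volume.restrict (Set.Ioc (0 : ℝ) (0 + 1))]
        ((fun y : UnitAddCircle => (AddCircle.equivIco (1 : ℝ) 0 y : ℝ)) ∘
          fun v : ℝ => (v : UnitAddCircle)) := by
      have h3 : ∀ᵐ v ∂(volume : Measure ℝ), v ≠ 1 := by
        simp [ae_iff, measure_singleton]
      filter_upwards [ae_restrict_mem measurableSet_Ioc, ae_restrict_of_ae h3] with v hv hv1
      have := AddCircle.coe_equivIco_mk_apply (p := (1 : ℝ)) v
      have h5 : Int.fract v = v :=
        Int.fract_eq_self.2 ⟨hv.1.le, lt_of_le_of_ne (by simpa using hv.2) hv1⟩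
      simp only [Function.comp]
      rw [div_one, mul_one, h5] at this
      exact this.symm
    rw [← Measure.map_congr h2, Measure.map_id']
    simp only [zero_add]
    exact (Measure.restrict_congr_set Ico_ae_eq_Ioc).symm
  exact h0.comp (measurePreserving_sub_right volume x)

/-! ### The map `f_r` -/

theorem cyclicMap_spec (X : Finset UnitAddCircle) (r : ℝ) (hr : 0 < r) (x : X) :
    cwDist x (cyclicMap X r hr x) < r ∧
      ∀ y' : X, cwDist x y' < r → cwDist x y' ≤ cwDist x (cyclicMap X r hr x) :=
  Classical.choose_spec (exists_furthest X r hr x)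

theorem cyclicMap_eq_iff {X : Finset UnitAddCircle} {r : ℝ} {hr : 0 < r} {x y : X} :
    cyclicMap X r hr x = y ↔
      cwDist x y < r ∧ ∀ y' : X, cwDist x y' < r → cwDist x y' ≤ cwDist x y := by
  constructor
  · rintro rfl
    exact cyclicMap_spec X r hr x
  · rintro ⟨h1, h2⟩
    have h := cyclicMap_spec X r hr x
    exact Subtype.ext (cwDist_injective x (le_antisymm (h2 _ h.1) (h.2 _ h1)))

/-- The real shifts `s` for which `x - k r + s` is a point of `X`. -/
def shiftSet (X : Finset UnitAddCircle) (r : ℝ) (x : UnitAddCircle) (k : ℕ) : Set ℝ :=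
  {s | x + ((s - k * r : ℝ) : UnitAddCircle) ∈ X}

/-- `s'` is the smallest element of `T` exceeding `s`. -/
def IsNext (T : Set ℝ) (s s' : ℝ) : Prop :=
  s' ∈ T ∧ s < s' ∧ ∀ τ ∈ T, s < τ → s' ≤ τ

/-- The displacement of the first `k` iterates of `f_r` starting at `y`. -/
noncomputable def displacement (X : Finset UnitAddCircle) (r : ℝ) (hr : 0 < r) : ℕ → X → ℝ
  | 0, _ => 0
  | k + 1, y => cwDist y (cyclicMap X r hr y) + displacement X r hr k (cyclicMap X r hr y)

theorem add_displacement (X : Finset UnitAddCircle) (r : ℝ) (hr : 0 < r) (k : ℕ) (y : X) :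
    (y : UnitAddCircle) + (displacement X r hr k y : ℝ) = ((cyclicMap X r hr)^[k] y : X) := by
  induction k generalizing y with
  | zero => simp [displacement]
  | succ k ih =>
    rw [Function.iterate_succ_apply, ← ih, displacement, AddCircle.coe_add, ← add_assoc, add_cwDist]

/-- In shifted coordinates `f_r` is the predecessor map from level `k + 1` to level `k`. -/
theorem cyclicMap_shift {X : Finset UnitAddCircle} {r : ℝ} (hr : 0 < r) (hr1 : r ≤ 1)
    {x : UnitAddCircle} {k : ℕ} {s : ℝ} {y : X}
    (hy : (y : UnitAddCircle) = x + ((s - (k + 1 : ℕ) * r : ℝ) : UnitAddCircle)) :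
    (s - r + cwDist y (cyclicMap X r hr y)) ∈ shiftSet X r x k ∧
      s - r + cwDist y (cyclicMap X r hr y) < s ∧
      ∀ τ ∈ shiftSet X r x k, τ < s → τ ≤ s - r + cwDist y (cyclicMap X r hr y) := by
  obtain ⟨h1, h2⟩ := cyclicMap_spec X r hr y
  refine ⟨?_, by linarith, ?_⟩
  · have h3 := add_cwDist y (cyclicMap X r hr y)
    have : x + ((s - r + cwDist y (cyclicMap X r hr y) - k * r : ℝ) : UnitAddCircle)
        = cyclicMap X r hr y := by
      generalize cwDist y (cyclicMap X r hr y) = c at h3 ⊢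
      rw [← h3, hy, add_assoc, ← AddCircle.coe_add]
      congr 2
      push_cast
      ring
    show x + _ ∈ X
    rw [this]
    exact (cyclicMap X r hr y).2
  · intro τ hτ hτs
    rcases lt_or_ge τ (s - r) with h | h
    · have := cwDist_nonneg y (cyclicMap X r hr y)
      linarith
    · have h4 := h2 ⟨_, hτ⟩
      have h5 : cwDist y (x + ((τ - k * r : ℝ) : UnitAddCircle)) = τ - (s - r) := by
        refine cwDist_eq_of_mem ?_ (by linarith) (by linarith)
        rw [hy, add_assoc, ← AddCircle.coe_add]
        congr 2
        push_cast
        ring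
      simp only [h5] at h4
      have := h4 (by linarith)
      linarith

/-! ### Images of iterates via threshold sequences -/

section GapSequences

variable {X : Finset UnitAddCircle} {r : ℝ} {x : UnitAddCircle} {i : ℕ} {A B : ℕ → ℝ}

/-- Where the `k`-th iterate of `f_r` lands relative to `x` is decided by the thresholds
`A k` and `B (k - 1)`. -/
theorem displacement_threshold (hr : 0 < r) (hr1 : r ≤ 1) (hx : x ∈ X)
    (hA0 : A 0 = 0) (hB0 : B 0 = 0)
    (hA : ∀ k ≤ i, IsNext (shiftSet X r x k) (A k) (A (k + 1)))
    (hB : ∀ k ≤ i, IsNext (shiftSet X r x (k + 1)) (B k) (B (k + 1)))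
    (k : ℕ) (hk : k ≤ i) (s : ℝ) (y : X)
    (hy : (y : UnitAddCircle) = x + ((s - (k + 1 : ℕ) * r : ℝ) : UnitAddCircle)) :
    (s - (k + 1 : ℕ) * r + displacement X r hr (k + 1) y ≤ 0 ↔ s ≤ A (k + 1)) ∧
      (0 ≤ s - (k + 1 : ℕ) * r + displacement X r hr (k + 1) y ↔ B k < s) := by
  obtain ⟨h1, h2, h3⟩ := cyclicMap_shift hr hr1 hy
  set s' := s - r + cwDist y (cyclicMap X r hr y) with hs'
  -- The predecessor of `s` is at most `A k` exactly when no point of T_k lies strictly between `A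
  -- k` and `s`.
  have key : s' ≤ A k ↔ s ≤ A (k + 1) := by
    obtain ⟨n1, n2, n3⟩ := hA k hk
    constructor
    · intro h
      by_contra! hlt
      linarith [h3 _ n1 hlt]
    · intro h
      by_contra! hlt
      linarith [n3 _ h1 hlt]
  induction k generalizing s y with
  | zero =>
    have h0 : (0 : ℝ) ∈ shiftSet X r x 0 := by simpa [shiftSet] using hx
    have e : s - (0 + 1 : ℕ) * r + displacement X r hr (0 + 1) y = s' := by
      simp [displacement, hs']
    rw [e, hB0, ← key, hA0]
    refine ⟨Iff.rfl, fun h => by linarith, fun h => h3 _ h0 h⟩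
  | succ k ih =>
    have hy' : (cyclicMap X r hr y : UnitAddCircle)
        = x + ((s' - (k + 1 : ℕ) * r : ℝ) : UnitAddCircle) := by
      have h3 := add_cwDist y (cyclicMap X r hr y)
      rw [hs']
      generalize cwDist y (cyclicMap X r hr y) = c at h3 ⊢
      rw [← h3, hy, add_assoc, ← AddCircle.coe_add]
      congr 2
      push_cast
      ring
    obtain ⟨m1, m2, m3⟩ := cyclicMap_shift hr hr1 hy'
    have key' : s' - r + cwDist (cyclicMap X r hr y) (cyclicMap X r hr (cyclicMap X r hr y)) ≤ A k
        ↔ s' ≤ A (k + 1) := by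
      obtain ⟨n1, n2, n3⟩ := hA k (by omega)
      constructor
      · intro h
        by_contra! hlt
        linarith [m3 _ n1 hlt]
      · intro h
        by_contra! hlt
        linarith [n3 _ m1 hlt]
    obtain ⟨g1, g2⟩ := ih (by omega) s' _ hy' m1 m2 m3 rfl key'
    have e : s - (k + 1 + 1 : ℕ) * r + displacement X r hr (k + 1 + 1) y
        = s' - (k + 1 : ℕ) * r + displacement X r hr (k + 1) (cyclicMap X r hr y) := by
      rw [displacement, hs']
      push_cast
      ring
    rw [e, g1, g2, key]
    refine ⟨Iff.rfl, ?_⟩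
    obtain ⟨n1, n2, n3⟩ := hB k (by omega)
    constructor
    · intro h
      linarith [n3 _ h1 h]
    · intro h
      linarith [h3 _ n1 h]

/-- An iterate hits `x` exactly when its lifted landing offset is 0, so by the thresholds some point
of T_{k+1} must lie in (B_k, A_{k+1}]. The first candidate after B_k is B_{k+1}. -/
theorem mem_range_iterate_iff (hr : 0 < r) (hr1 : r ≤ 1) (hx : x ∈ X)
    (hA0 : A 0 = 0) (hB0 : B 0 = 0)
    (hA : ∀ k ≤ i, IsNext (shiftSet X r x k) (A k) (A (k + 1)))
    (hB : ∀ k ≤ i, IsNext (shiftSet X r x (k + 1)) (B k) (B (k + 1)))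
    (k : ℕ) (hk : k ≤ i) :
    (⟨x, hx⟩ : X) ∈ Set.range (cyclicMap X r hr)^[k + 1] ↔ B (k + 1) ≤ A (k + 1) := by
  have thr := displacement_threshold hr hr1 hx hA0 hB0 hA hB k hk
  constructor
  · rintro ⟨y, hy⟩
    set v := cwDist x y + (k + 1 : ℕ) * r with hv
    have hyv : (y : UnitAddCircle) = x + ((v - (k + 1 : ℕ) * r : ℝ) : UnitAddCircle) := by
      rw [hv, add_sub_cancel_right, add_cwDist]
    have hd := add_displacement X r hr (k + 1) y
    rw [hy] at hd
    have : ((v - (k + 1 : ℕ) * r + displacement X r hr (k + 1) y : ℝ) : UnitAddCircle)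
        = ((0 : ℝ) : UnitAddCircle) := by
      rw [AddCircle.coe_add]
      have h5 : x + (((v - (k + 1 : ℕ) * r : ℝ) : UnitAddCircle)
        + (displacement X r hr (k + 1) y : ℝ)) = x := by
        rw [← add_assoc, ← hyv, hd]
      simpa using h5
    obtain ⟨m, hm⟩ := coe_eq_coe_iff_sub_int.1 this
    -- The lift `v` only guarantees an integer landing offset `m`; the lift `v - m` lands at 0
    -- itself.
    have hyv' : (y : UnitAddCircle) = x + (((v - m) - (k + 1 : ℕ) * r : ℝ) : UnitAddCircle) := by
      rw [hyv]
      congr 1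
      rw [coe_eq_coe_iff_sub_int]
      exact ⟨m, by ring⟩
    obtain ⟨g1, g2⟩ := thr _ y hyv'
    have h6 := g1.1 (by linarith)
    have h7 := g2.1 (by linarith)
    have h8 : v - m ∈ shiftSet X r x (k + 1) := by
      show x + _ ∈ X
      rw [← hyv']
      exact y.2
    exact ((hB k hk).2.2 _ h8 h7).trans h6
  · intro h
    obtain ⟨n1, n2, n3⟩ := hB k hk
    refine ⟨⟨_, n1⟩, ?_⟩
    obtain ⟨g1, g2⟩ := thr (B (k + 1)) ⟨_, n1⟩ rfl
    have h0 := le_antisymm (g1.2 h) (g2.2 n2)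
    have hd := add_displacement X r hr (k + 1) ⟨_, n1⟩
    rw [add_assoc, ← AddCircle.coe_add, h0] at hd
    exact Subtype.ext (by simpa using hd.symm)

/-- The number of points of `f_r^i(X) \ f_r^{i+1}(X)`; such points are never periodic. -/
theorem lev_eq (X : Finset UnitAddCircle) (r : ℝ) (hr : 0 < r) (i : ℕ) :
    lev X r hr i = Set.ncard {x : X | x ∈ Set.range (cyclicMap X r hr)^[i] ∧
      x ∉ Set.range (cyclicMap X r hr)^[i + 1]} := by
  unfold lev
  congr 1
  ext x
  simp only [Set.mem_ofPred_eq, and_iff_right_iff_imp, and_imp]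
  rintro - h ⟨m, hm, hper⟩
  apply h
  -- A multiple of the period that is at least `i + 1` exhibits a periodic point in the image of the
  -- iterate of order `i + 1`.
  have h2 : (cyclicMap X r hr)^[m * (i + 1)] x = x := (hper.mul_const (i + 1)).eq
  refine ⟨(cyclicMap X r hr)^[m * (i + 1) - (i + 1)] x, ?_⟩
  rw [← Function.iterate_add_apply]
  have : i + 1 + (m * (i + 1) - (i + 1)) = m * (i + 1) := by
    have : i + 1 ≤ m * (i + 1) := Nat.le_mul_of_pos_left _ hm
    omega
  rw [this, h2]

end GapSequences

/-! ### Gap vectors -/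

section GapVectors

variable {i : ℕ}

@[simp] theorem zSum_zero (u : GapSpace i) : zSum u 0 = 0 := by simp [zSum]

@[simp] theorem wSum_zero (u : GapSpace i) : wSum u 0 = 0 := by simp [wSum]

theorem filter_val_lt_succ (a : Fin (i + 1)) :
    (Finset.univ.filter fun b : Fin (i + 1) => b.val < a.val + 1)
      = insert a (Finset.univ.filter fun b : Fin (i + 1) => b.val < a.val) := by
  ext b
  simp [Fin.ext_iff]
  omega

theorem zSum_succ (u : GapSpace i) (a : Fin (i + 1)) :
    zSum u (a + 1) = zSum u a + u (Sum.inl a) := by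
  rw [zSum, filter_val_lt_succ, Finset.sum_insert (by simp), add_comm, zSum]

theorem wSum_succ (u : GapSpace i) (b : Fin (i + 1)) :
    wSum u (b + 1) = wSum u b + u (Sum.inr b) := by
  rw [wSum, filter_val_lt_succ, Finset.sum_insert (by simp), add_comm, wSum]

theorem zSum_mono {u : GapSpace i} (hu : ∀ a, 0 ≤ u a) : Monotone (zSum u) := fun j k h =>
  Finset.sum_le_sum_of_subset_of_nonneg
    (fun a ha => by simp only [Finset.mem_filter] at ha ⊢; exact ⟨ha.1, by omega⟩)
    fun a _ _ => hu _

theorem wSum_mono {u : GapSpace i} (hu : ∀ a, 0 ≤ u a) : Monotone (wSum u) := fun j k h =>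
  Finset.sum_le_sum_of_subset_of_nonneg
    (fun a ha => by simp only [Finset.mem_filter] at ha ⊢; exact ⟨ha.1, by omega⟩)
    fun a _ _ => hu _

/-- The number of backward rotations by `r` to the place where a gap is measured. -/
def lag : Fin (i + 1) ⊕ Fin (i + 1) → ℕ
  | Sum.inl a => a
  | Sum.inr b => b + 1

/-- The starting offset of a gap. -/
noncomputable def gapLo (u : GapSpace i) : Fin (i + 1) ⊕ Fin (i + 1) → ℝ
  | Sum.inl a => zSum u a
  | Sum.inr b => wSum u b

/-- The final offset of a gap. -/
noncomputable def gapHi (u : GapSpace i) : Fin (i + 1) ⊕ Fin (i + 1) → ℝ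
  | Sum.inl a => zSum u (a + 1)
  | Sum.inr b => wSum u (b + 1)

theorem gapHi_eq (u : GapSpace i) (c : Fin (i + 1) ⊕ Fin (i + 1)) :
    gapHi u c = gapLo u c + u c := by
  rcases c with a | b
  · exact zSum_succ u a
  · exact wSum_succ u b

theorem lag_le (c : Fin (i + 1) ⊕ Fin (i + 1)) : lag c ≤ i + 1 := by
  rcases c with a | b <;> simp only [lag] <;> omega

theorem gapLo_nonneg {u : GapSpace i} (hu : ∀ a, 0 ≤ u a) (c : Fin (i + 1) ⊕ Fin (i + 1)) :
    0 ≤ gapLo u c := by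
  rcases c with a | b
  · simpa [gapLo] using zSum_mono hu (Nat.zero_le a)
  · simpa [gapLo] using wSum_mono hu (Nat.zero_le b)

theorem l1Norm_eq {u : GapSpace i} (hu : ∀ a, 0 ≤ u a) : l1Norm u = ∑ a, u a :=
  Finset.sum_congr rfl fun a _ => abs_of_nonneg (hu a)

theorem gapHi_le {u : GapSpace i} (hu : ∀ a, 0 ≤ u a) (c : Fin (i + 1) ⊕ Fin (i + 1)) :
    gapHi u c ≤ l1Norm u := by
  have hz : ∀ k, 0 ≤ zSum u k := fun k => Finset.sum_nonneg fun a _ => hu _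
  have hw : ∀ k, 0 ≤ wSum u k := fun k => Finset.sum_nonneg fun a _ => hu _
  have h : zSum u (i + 1) + wSum u (i + 1) = l1Norm u := by
    rw [l1Norm_eq hu, Fintype.sum_sum_type, zSum, wSum, Finset.filter_true_of_mem
      (fun a _ => a.2)]
  rcases c with a | b
  · have := zSum_mono hu (show (a : ℕ) + 1 ≤ i + 1 by omega)
    simp only [gapHi]
    linarith [hw (i + 1)]
  · have := wSum_mono hu (show (b : ℕ) + 1 ≤ i + 1 by omega)
    simp only [gapHi]
    linarith [hz (i + 1)]

/-- The coordinates of `u` are the successive gaps of `X` met while tracing the preimages of `x`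
and of the next point of `X` backwards. -/
def IsGapVector (X : Finset UnitAddCircle) (r : ℝ) (x : UnitAddCircle) (u : GapSpace i) : Prop :=
  ∀ c, IsNext (shiftSet X r x (lag c)) (gapLo u c) (gapHi u c)

variable {X : Finset UnitAddCircle} {r : ℝ} {x : UnitAddCircle} {u : GapSpace i}

theorem IsGapVector.zSum (h : IsGapVector X r x u) (k : ℕ) (hk : k ≤ i) :
    IsNext (shiftSet X r x k) (zSum u k) (zSum u (k + 1)) :=
  h (Sum.inl ⟨k, by omega⟩)

theorem IsGapVector.wSum (h : IsGapVector X r x u) (k : ℕ) (hk : k ≤ i) :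
    IsNext (shiftSet X r x (k + 1)) (wSum u k) (wSum u (k + 1)) :=
  h (Sum.inr ⟨k, by omega⟩)

theorem IsGapVector.pos (h : IsGapVector X r x u) (c : Fin (i + 1) ⊕ Fin (i + 1)) : 0 < u c := by
  have := (h c).2.1
  rw [gapHi_eq] at this
  linarith

theorem IsNext.unique {T : Set ℝ} {s a b : ℝ} (ha : IsNext T s a) (hb : IsNext T s b) : a = b :=
  le_antisymm (ha.2.2 _ hb.1 hb.2.1) (hb.2.2 _ ha.1 ha.2.1)

theorem IsGapVector.unique {v : GapSpace i} (hu : IsGapVector X r x u)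
    (hv : IsGapVector X r x v) : u = v := by
  have hz : ∀ k ≤ i + 1, _root_.zSum u k = _root_.zSum v k := by
    intro k hk
    induction k with
    | zero => simp
    | succ k ih =>
      have h := hu.zSum k (by omega)
      rw [ih (by omega)] at h
      exact h.unique (hv.zSum k (by omega))
  have hw : ∀ k ≤ i + 1, _root_.wSum u k = _root_.wSum v k := by
    intro k hk
    induction k with
    | zero => simp
    | succ k ih =>
      have h := hu.wSum k (by omega)
      rw [ih (by omega)] at h
      exact h.unique (hv.wSum k (by omega))
  ext c
  rcases c with a | b
  · have h1 := zSum_succ u a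
    have h2 := zSum_succ v a
    rw [hz _ (by omega), hz _ (by omega)] at h1
    linarith
  · have h1 := wSum_succ u b
    have h2 := wSum_succ v b
    rw [hw _ (by omega), hw _ (by omega)] at h1
    linarith

/-- The next point clockwise after a position is the one from which that position is clockwise
furthest. -/
theorem exists_isNext (hX : X.Nonempty) (r : ℝ) (x : UnitAddCircle) (k : ℕ) (s : ℝ) :
    ∃ s', IsNext (shiftSet X r x k) s s' := by
  obtain ⟨y, hy, hmax⟩ := Finset.exists_max_image X
    (fun y => cwDist y (x + ((s - k * r : ℝ) : UnitAddCircle))) hX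
  set p : UnitAddCircle := x + ((s - k * r : ℝ) : UnitAddCircle) with hp
  refine ⟨s + (1 - cwDist y p), ?_, by linarith [cwDist_lt_one y p], ?_⟩
  · show x + _ ∈ X
    have : x + ((s + (1 - cwDist y p) - k * r : ℝ) : UnitAddCircle) = y := by
      conv_rhs => rw [eq_add_one_sub_cwDist p y]
      generalize 1 - cwDist y p = c
      rw [hp, add_assoc, ← AddCircle.coe_add]
      congr 2
      ring
    rwa [this]
  · intro τ hτ hs
    have h1 := hmax _ hτ
    have h2 : x + ((τ - k * r : ℝ) : UnitAddCircle) = p + ((τ - s : ℝ) : UnitAddCircle) := by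
      rw [hp, add_assoc, ← AddCircle.coe_add]
      congr 2
      ring
    have h3 := one_sub_cwDist_le_of_pos h2 (by linarith)
    linarith

theorem exists_isGapVector (hX : X.Nonempty) (r : ℝ) (x : UnitAddCircle) :
    ∃ u : GapSpace i, IsGapVector X r x u := by
  choose nxt hnxt using exists_isNext hX r x
  let A : ℕ → ℝ := fun k => Nat.rec 0 (fun k a => nxt k a) k
  let B : ℕ → ℝ := fun k => Nat.rec 0 (fun k a => nxt (k + 1) a) k
  let u : GapSpace i := Sum.elim (fun a => A (a + 1) - A a) (fun b => B (b + 1) - B b)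
  have hz : ∀ k ≤ i + 1, zSum u k = A k := by
    intro k hk
    induction k with
    | zero => simp [A]
    | succ k ih =>
      have := zSum_succ u ⟨k, by omega⟩
      simp only [ih (by omega)] at this
      rw [this]
      simp [u]
  have hw : ∀ k ≤ i + 1, wSum u k = B k := by
    intro k hk
    induction k with
    | zero => simp [B]
    | succ k ih =>
      have := wSum_succ u ⟨k, by omega⟩
      simp only [ih (by omega)] at this
      rw [this]
      simp [u]
  refine ⟨u, ?_⟩
  rintro (a | b)
  · simp only [lag, gapLo, gapHi]
    rw [hz _ (by omega), hz _ (by omega)]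
    exact hnxt _ _
  · simp only [lag, gapLo, gapHi]
    rw [hw _ (by omega), hw _ (by omega)]
    exact hnxt _ _

/-- Images of iterates are nested, so membership in the i-th one yields every H(j,j) with j ≤ i,
although H(i,i) alone suffices for the converse. -/
theorem level_iff_mem_coneK (hr : 0 < r) (hr1 : r ≤ 1) (hx : x ∈ X) (hu : IsGapVector X r x u) :
    ((⟨x, hx⟩ : X) ∈ Set.range (cyclicMap X r hr)^[i] ∧
      (⟨x, hx⟩ : X) ∉ Set.range (cyclicMap X r hr)^[i + 1]) ↔ u ∈ coneK i := by
  have key := mem_range_iterate_iff (i := i) hr hr1 hx (zSum_zero u) (wSum_zero u) hu.zSum hu.wSum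
  constructor
  · rintro ⟨⟨y, hy⟩, h2⟩
    refine ⟨fun a => (hu.pos a).le, fun j hj hji => ?_, fun h => h2 ((key i le_rfl).2 h)⟩
    obtain ⟨k, rfl⟩ : ∃ k, j = k + 1 := ⟨j - 1, by omega⟩
    refine (key k (by omega)).1 ⟨(cyclicMap X r hr)^[i - (k + 1)] y, ?_⟩
    rw [← Function.iterate_add_apply, ← hy]
    congr 2
    omega
  · rintro ⟨-, h1, h2⟩
    refine ⟨?_, fun h => h2 ((key i le_rfl).1 h)⟩
    rcases i with _ | i
    · simp
    · exact (key i (by omega)).2 (h1 _ (by omega) le_rfl)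

/-- `q` is the least positive integer for which `q r` is an integer, as far as multiples up to
`(i + 1) r` are concerned. -/
structure IsDenom (r : ℝ) (i q : ℕ) : Prop where
  pos : 1 ≤ q
  le_of_int : ∀ d : ℕ, 1 ≤ d → d ≤ i + 1 → ∀ m : ℤ, (d : ℝ) * r = m → q ≤ d
  int : q ≤ i + 1 → ∃ m : ℤ, (q : ℝ) * r = m

theorem IsDenom.shiftSet_add {q : ℕ} (hq : IsDenom r i q) (h : q ≤ i + 1) (X : Finset UnitAddCircle)
    (x : UnitAddCircle) (k : ℕ) : shiftSet X r x (k + q) = shiftSet X r x k := by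
  obtain ⟨m, hm⟩ := hq.int h
  ext s
  have : x + ((s - (k + q : ℕ) * r : ℝ) : UnitAddCircle)
      = x + ((s - k * r : ℝ) : UnitAddCircle) := by
    congr 1
    rw [coe_eq_coe_iff_sub_int]
    refine ⟨-m, ?_⟩
    push_cast
    rw [← hm]
    ring
  show _ ∈ X ↔ _ ∈ X
  rw [this]

/-- If some H(j,k) with k = j+q-2 held, the coincidence T_{j-1} = T_{k+1} would let the A-sequence
dominate the B-sequence from there on, up to B_{i+1} ≤ A_{i+1}, which K_i excludes. -/
theorem mem_coneKq_of_mem_coneK {q : ℕ} (hq : IsDenom r i q)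
    (hgen : ∀ y ∈ X, ∀ z ∈ X, y + (r : UnitAddCircle) = z → y = z)
    (hu : IsGapVector X r x u) (hK : u ∈ coneK i) : u ∈ coneKq i q := by
  refine ⟨hK, fun j k hj hjk hki hge => ?_⟩
  have hq1 := hq.pos
  have hpos := fun c => (hu.pos c).le
  have hqi : q ≤ i + 1 := by omega
  replace hge : wSum u k ≤ zSum u j := hge
  have hlt : wSum u k < zSum u j := by
    refine lt_of_le_of_ne hge fun heq => ?_
    have hBA : ∀ k ≤ i, wSum u k ≤ zSum u k := fun k hk => by
      rcases Nat.eq_zero_or_pos k with rfl | h0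
      · simp
      · exact hK.2.1 k h0 hk
    -- For k > 0, equality puts two points of `X` at distance `r`; genericity makes them equal, so
    -- `r` is an integer. But if q = 1 then j = k+1, and A_{k+1} > A_k ≥ B_k rules equality out.
    have hq1' : q = 1 := by
      rcases Nat.eq_zero_or_pos k with rfl | h0
      · omega
      obtain ⟨k', rfl⟩ : ∃ k', k = k' + 1 := ⟨k - 1, by omega⟩
      obtain ⟨j', rfl⟩ : ∃ j', j = j' + 1 := ⟨j - 1, by omega⟩
      have h1 := (hu.wSum k' (by omega)).1
      have h2 := (hu.zSum j' (by omega)).1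
      rw [← hq.shiftSet_add hqi, show j' + q = k' + 1 + 1 by omega, ← heq] at h2
      have h3 := hgen _ h2 _ h1 ?_
      · have h4 := add_left_cancel h3
        rw [coe_eq_coe_iff_sub_int] at h4
        obtain ⟨m, hm⟩ := h4
        have := hq.le_of_int 1 le_rfl (by omega) (-m) (by push_cast at hm ⊢; linarith)
        omega
      · rw [add_assoc, ← AddCircle.coe_add]
        congr 2
        push_cast
        ring
    obtain rfl : j = k + 1 := by omega
    have h1 := (hu.zSum k hki).2.1
    have h2 := hBA k hki
    linarith
  -- Each A_{j+m} belongs to T_{k+m+1} and exceeds B_{k+m}, so it bounds the successor B_{k+m+1}.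
  have main : ∀ m, k + m ≤ i → wSum u (k + m + 1) ≤ zSum u (j + m) := by
    intro m
    induction m with
    | zero =>
      intro _
      obtain ⟨j', rfl⟩ : ∃ j', j = j' + 1 := ⟨j - 1, by omega⟩
      have h2 := (hu.zSum j' (by omega)).1
      rw [← hq.shiftSet_add hqi, show j' + q = k + 1 by omega] at h2
      exact (hu.wSum k hki).2.2 _ h2 hlt
    | succ m ih =>
      intro hm
      have h1 := hu.wSum (k + (m + 1)) hm
      have h2 := hu.zSum (j + m) (by omega)
      rw [← hq.shiftSet_add hqi, show j + m + q = k + (m + 1) + 1 by omega] at h2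
      exact h1.2.2 _ h2.1 (lt_of_le_of_lt (ih (by omega)) h2.2.1)
  have h1 := main (i - k) (by omega)
  rw [show k + (i - k) = i by omega] at h1
  exact hK.2.2 (h1.trans (zSum_mono hpos (by omega)))

/-- Gaps measured at congruent places occupy disjoint half-open intervals. -/
theorem gap_disjoint {q : ℕ} (hq : IsDenom r i q) (hu : u ∈ coneKq i q)
    {c c' : Fin (i + 1) ⊕ Fin (i + 1)} (hne : c ≠ c')
    (hint : ∃ m : ℤ, ((lag c : ℝ) - lag c') * r = m) :
    gapHi u c ≤ gapLo u c' ∨ gapHi u c' ≤ gapLo u c := by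
  obtain ⟨⟨hpos, hH, -⟩, hN⟩ := hu
  have hBA : ∀ k ≤ i, wSum u k ≤ zSum u k := fun k hk => by
    rcases Nat.eq_zero_or_pos k with rfl | h0
    · simp
    · exact hH k h0 hk
  have hzm := zSum_mono hpos
  have hwm := wSum_mono hpos
  have hq1 := hq.pos
  -- Lags l < l' that are congruent differ by at least q. The first gap ends by A_{l+1}, the second
  -- starts no earlier than B_{l'-1} ≥ B_{l+q-1}, and ¬H(l+1, l+q-1) separates them.
  have far : ∀ c c' : Fin (i + 1) ⊕ Fin (i + 1), lag c < lag c' →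
      (∃ m : ℤ, ((lag c : ℝ) - lag c') * r = m) → gapHi u c ≤ gapLo u c' := by
    intro c c' hlt ⟨m, hm⟩
    have hl' := lag_le c'
    have hd := hq.le_of_int (lag c' - lag c) (by omega) (by omega) (-m)
      (by rw [Nat.cast_sub hlt.le]; push_cast; linarith)
    have h1 : gapHi u c ≤ zSum u (lag c + 1) := by
      rcases c with a | b
      · exact le_rfl
      · have hl : lag (Sum.inr b) = (b : ℕ) + 1 := rfl
        exact (hBA _ (by omega)).trans (hzm (by omega))
    have h2 : wSum u (lag c' - 1) ≤ gapLo u c' := by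
      rcases c' with a | b
      · exact (hwm (by simp only [lag]; omega)).trans (hBA _ (by omega))
      · exact le_rfl
    have h3 : wSum u (lag c + q - 1) ≤ wSum u (lag c' - 1) := hwm (by omega)
    have h4 := hN (lag c + 1) (lag c + q - 1) (by omega) (by omega) (by omega)
    have h5 : zSum u (lag c + 1) < wSum u (lag c + q - 1) := not_le.1 h4
    linarith
  rcases lt_trichotomy (lag c) (lag c') with h | h | h
  · exact Or.inl (far c c' h hint)
  -- Equal lags for different gaps pair a w-gap ending at B_a with the z-gap starting at A_a, which
  -- H(a,a) separates.
  · have near : ∀ (a b : Fin (i + 1)), (a : ℕ) = b + 1 → wSum u (b + 1) ≤ zSum u a :=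
      fun a b hab => by rw [← hab]; exact hBA _ (by omega)
    rcases c with a | b <;> rcases c' with a' | b' <;> simp only [lag] at h
    · exact absurd (congrArg Sum.inl (Fin.ext h)) hne
    · exact Or.inr (near _ _ h)
    · exact Or.inl (near _ _ h.symm)
    · exact absurd (congrArg Sum.inr (Fin.ext (by omega))) hne
  · obtain ⟨m, hm⟩ := hint
    exact Or.inr (far c' c h ⟨-m, by push_cast; linarith⟩)

end GapVectors

/-! ### The change of variables from gaps to positions -/

section GapEquiv

variable {i : ℕ}

/-- The matrix of partial summation. -/
def partialSumMatrix (i : ℕ) : Matrix (Fin (i + 1)) (Fin (i + 1)) ℝ :=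
  Matrix.of fun a b => if b ≤ a then 1 else 0

/-- The matrix of the linear map `gapHi`. -/
def gapMatrix (i : ℕ) : Matrix (Fin (i + 1) ⊕ Fin (i + 1)) (Fin (i + 1) ⊕ Fin (i + 1)) ℝ :=
  Matrix.fromBlocks (partialSumMatrix i) 0 0 (partialSumMatrix i)

theorem det_partialSumMatrix (i : ℕ) : (partialSumMatrix i).det = 1 := by
  rw [Matrix.det_of_isLowerTriangular]
  · simp [partialSumMatrix]
  · intro a b hab
    have : a < b := hab
    simp [partialSumMatrix, this]

theorem det_gapMatrix (i : ℕ) : (gapMatrix i).det = 1 := by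
  rw [gapMatrix, Matrix.det_fromBlocks_zero₂₁, det_partialSumMatrix, one_mul]

theorem gapMatrix_mulVec (u : GapSpace i) : (gapMatrix i).mulVec u = gapHi u := by
  have h (v : Fin (i + 1) → ℝ) (a : Fin (i + 1)) :
      (partialSumMatrix i).mulVec v a = ∑ b : Fin (i + 1) with b.val < a.val + 1, v b := by
    simp only [Matrix.mulVec, dotProduct, partialSumMatrix, Matrix.of_apply, ite_mul, one_mul,
      zero_mul, Finset.sum_ite, Finset.sum_const_zero, add_zero]
    exact Finset.sum_congr (Finset.filter_congr fun b _ => by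
      rw [Fin.le_def, Nat.lt_succ_iff]) fun _ _ => rfl
  rw [gapMatrix, Matrix.fromBlocks_mulVec]
  ext c
  rcases c with a | b
  · simp [h, gapHi, zSum]
  · simp [h, gapHi, wSum]

/-- The passage from gaps to final offsets, as an equivalence. -/
noncomputable def gapEquiv (i : ℕ) : GapSpace i ≃ᵐ GapSpace i :=
  (LinearEquiv.ofInjectiveEndo (Matrix.toLin' (gapMatrix i)) (by
    have : IsUnit (gapMatrix i) := by
      rw [Matrix.isUnit_iff_isUnit_det, det_gapMatrix]
      exact isUnit_one
    exact Matrix.mulVec_injective_of_isUnit this)).toContinuousLinearEquiv.toHomeomorph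
      |>.toMeasurableEquiv

theorem gapEquiv_apply (u : GapSpace i) : gapEquiv i u = gapHi u := gapMatrix_mulVec u

theorem measurePreserving_gapEquiv : MeasurePreserving (gapEquiv i) volume volume := by
  refine ⟨(gapEquiv i).measurable, ?_⟩
  have h := Real.map_matrix_volume_pi_eq_smul_volume_pi (M := gapMatrix i)
    (by rw [det_gapMatrix]; exact one_ne_zero)
  rw [det_gapMatrix] at h
  simp only [inv_one, abs_one, ENNReal.ofReal_one, one_smul] at h
  exact h

end GapEquiv

/-! ### Configurations of labelled sample points -/

section Configurations

variable {i : ℕ}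

/-- The gaps encoded by the positions `v` relative to a base point. -/
noncomputable def decodeGaps (r : ℝ) (v : Fin (i + 1) ⊕ Fin (i + 1) → UnitAddCircle) : GapSpace i :=
  (gapEquiv i).symm fun c => cwDist ((-(lag c * r) : ℝ) : UnitAddCircle) (v c)

/-- The open arc of a gap, relative to a base point. -/
def gapArc (r : ℝ) (u : GapSpace i) (c : Fin (i + 1) ⊕ Fin (i + 1)) : Set UnitAddCircle :=
  {y | cwDist ((-(lag c * r) : ℝ) : UnitAddCircle) y ∈ Set.Ioo (gapLo u c) (gapHi u c)}

/-- The part of `coneKq i q` with positive coordinates and norm less than `ε`. -/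
def smallCone (i q : ℕ) (ε : ℝ) : Set (GapSpace i) :=
  {u | u ∈ coneKq i q ∧ (∀ c, 0 < u c) ∧ l1Norm u < ε}

/-- `ε` bounds from below the nonzero distances of the numbers `(k - k') r` to the integers. -/
structure IsSep (r : ℝ) (i : ℕ) (ε : ℝ) : Prop where
  pos : 0 < ε
  lt_one : ε < 1
  eq_of_lt : ∀ k k' : ℕ, k ≤ i + 1 → k' ≤ i + 1 → ∀ m : ℤ,
    |((k : ℝ) - k') * r - m| < ε → ((k : ℝ) - k') * r = m

/-- Only finitely many multiples of `r` occur: below 1 an integer multiple is near no other integer,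
and a non-integer one is bounded away from its nearest integer. -/
theorem exists_isSep (r : ℝ) (i : ℕ) : ∃ ε, IsSep r i ε := by
  have h1 : ∀ k k' : ℕ, ∀ᶠ ε : ℝ in 𝓝[>] 0, ∀ m : ℤ,
      |((k : ℝ) - k') * r - m| < ε → ((k : ℝ) - k') * r = m := by
    intro k k'
    set v := ((k : ℝ) - k') * r
    by_cases hv : ∃ m : ℤ, v = m
    · obtain ⟨m, hm⟩ := hv
      filter_upwards [Ioo_mem_nhdsGT (show (0 : ℝ) < 1 by norm_num)] with ε hε m' hm'
      rw [hm] at hm' ⊢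
      have : |m - m'| < 1 := by
        have := hm'.trans hε.2
        exact_mod_cast this
      have := Int.abs_lt_one_iff.1 this
      exact_mod_cast sub_eq_zero.1 this
    · push Not at hv
      have h0 : 0 < |v - round v| := abs_pos.2 (sub_ne_zero.2 (hv _))
      filter_upwards [Ioo_mem_nhdsGT h0] with ε hε m hm
      have := round_le v m
      linarith [hε.2]
  have h2 : ∀ᶠ ε : ℝ in 𝓝[>] 0, ∀ k ∈ Finset.range (i + 2), ∀ k' ∈ Finset.range (i + 2),
      ∀ m : ℤ, |((k : ℝ) - k') * r - m| < ε → ((k : ℝ) - k') * r = m := by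
    rw [Filter.eventually_all_finset]
    intro k _
    rw [Filter.eventually_all_finset]
    intro k' _
    exact h1 k k'
  obtain ⟨ε, hε, h3⟩ := (h2.and (Ioo_mem_nhdsGT (show (0 : ℝ) < 1 by norm_num))).exists
  exact ⟨ε, h3.1, h3.2, fun k k' hk hk' =>
    hε k (by simpa [Nat.lt_succ_iff] using hk) k' (by simpa [Nat.lt_succ_iff] using hk')⟩

variable {r : ℝ} {q : ℕ} {ε : ℝ} {u : GapSpace i}

theorem smallCone.lo_nonneg (hu : u ∈ smallCone i q ε) (c : Fin (i + 1) ⊕ Fin (i + 1)) :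
    0 ≤ gapLo u c := gapLo_nonneg hu.1.1.1 c

theorem smallCone.hi_lt (hu : u ∈ smallCone i q ε) (c : Fin (i + 1) ⊕ Fin (i + 1)) :
    gapHi u c < ε := (gapHi_le hu.1.1.1 c).trans_lt hu.2.2

/-- Different gaps, closed at their final points, are disjoint on the circle. -/
theorem smallCone.eq_of_mem (hε : IsSep r i ε) (hq : IsDenom r i q) (hu : u ∈ smallCone i q ε)
    {c c' : Fin (i + 1) ⊕ Fin (i + 1)} {v v' : ℝ}
    (hv : v ∈ Set.Ioc (gapLo u c) (gapHi u c)) (hv' : v' ∈ Set.Ioc (gapLo u c') (gapHi u c'))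
    (h : ((v - lag c * r : ℝ) : UnitAddCircle) = ((v' - lag c' * r : ℝ) : UnitAddCircle)) :
    c = c' ∧ v = v' := by
  obtain ⟨m, hm⟩ := coe_eq_coe_iff_sub_int.1 h
  have h1 := smallCone.lo_nonneg hu c
  have h2 := smallCone.lo_nonneg hu c'
  have h3 := smallCone.hi_lt hu c
  have h4 := smallCone.hi_lt hu c'
  have hlt : |v - v'| < ε := abs_sub_lt_iff.2
    ⟨by linarith [hv.1, hv.2, hv'.1, hv'.2], by linarith [hv.1, hv.2, hv'.1, hv'.2]⟩
  have hint := hε.eq_of_lt (lag c) (lag c') (lag_le c) (lag_le c') (-m) (by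
    rw [show ((lag c : ℝ) - lag c') * r - ((-m : ℤ) : ℝ) = v - v' by push_cast; linarith]
    exact hlt)
  have hvv : v = v' := by push_cast at hint; linarith
  refine ⟨?_, hvv⟩
  by_contra hne
  rcases gap_disjoint hq hu.1 hne ⟨_, hint⟩ with h | h
  · linarith [hv.2, hv'.1]
  · linarith [hv'.2, hv.1]

/-- The base point lies in no gap closed at its final point. -/
theorem smallCone.coe_ne_zero (hε : IsSep r i ε) (hu : u ∈ smallCone i q ε)
    {c : Fin (i + 1) ⊕ Fin (i + 1)} {v : ℝ} (hv : v ∈ Set.Ioc (gapLo u c) (gapHi u c)) :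
    ((v - lag c * r : ℝ) : UnitAddCircle) ≠ 0 := by
  intro h
  rw [← AddCircle.coe_zero, coe_eq_coe_iff_sub_int] at h
  obtain ⟨m, hm⟩ := h
  have h1 := smallCone.lo_nonneg hu c
  have h3 := smallCone.hi_lt hu c
  have hint := hε.eq_of_lt (lag c) 0 (lag_le c) (by omega) (-m) (by
    rw [show ((lag c : ℝ) - (0 : ℕ)) * r - ((-m : ℤ) : ℝ) = v by push_cast; linarith, abs_of_pos]
    · linarith [hv.2]
    · linarith [hv.1])
  push_cast at hint
  linarith [hv.1]

variable {n : ℕ}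

/-- Positions relative to the base point, of the marked and of the remaining sample points. -/
noncomputable def relPos (σ : Option (Fin (i + 1) ⊕ Fin (i + 1)) ↪ Fin n) :
    (Fin n → UnitAddCircle) →+ (Fin (i + 1) ⊕ Fin (i + 1) → UnitAddCircle) ×
      ({a : Fin n // a ∉ Set.range σ} → UnitAddCircle) where
  toFun t := (fun c => t (σ (some c)) - t (σ none), fun a => t a - t (σ none))
  map_zero' := by ext <;> simp
  map_add' s t := by ext <;> simp <;> abel

/-- The configurations in which the gaps are those encoded by the marked points. -/
def config (r : ℝ) (i q : ℕ) (ε : ℝ) (κ : Type*) :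
    Set ((Fin (i + 1) ⊕ Fin (i + 1) → UnitAddCircle) × (κ → UnitAddCircle)) :=
  {p | decodeGaps r p.1 ∈ smallCone i q ε ∧ ∀ a c, p.2 a ∉ gapArc r (decodeGaps r p.1) c}

/-- The event that the marked points of the sample `t` witness that the base point has level `i`
and small gaps. -/
def markedEvent (r : ℝ) (i q : ℕ) (ε : ℝ) (σ : Option (Fin (i + 1) ⊕ Fin (i + 1)) ↪ Fin n) :
    Set (Fin n → UnitAddCircle) :=
  relPos σ ⁻¹' config r i q ε _

/-- The set of sample points. -/
noncomputable def pointSet (t : Fin n → UnitAddCircle) : Finset UnitAddCircle :=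
  Finset.univ.image t

/-- A sample point as an element of the set of sample points. -/
def samplePt (t : Fin n → UnitAddCircle) (b : Fin n) : pointSet t :=
  ⟨t b, Finset.mem_image_of_mem _ (Finset.mem_univ b)⟩

theorem cwDist_neg_eq {x y : UnitAddCircle} {k v : ℝ} (h : y = x + ((v - k : ℝ) : UnitAddCircle))
    (h0 : 0 ≤ v) (h1 : v < 1) : cwDist ((-k : ℝ) : UnitAddCircle) (y - x) = v := by
  refine cwDist_eq_of_mem ?_ h0 h1
  rw [h, add_sub_cancel_left, ← AddCircle.coe_add]
  congr 1
  ring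

theorem eq_add_coe_cwDist (x y : UnitAddCircle) (k : ℝ) :
    y = x + ((cwDist ((-k : ℝ) : UnitAddCircle) (y - x) - k : ℝ) : UnitAddCircle) := by
  have := add_cwDist ((-k : ℝ) : UnitAddCircle) (y - x)
  rw [sub_eq_neg_add (cwDist _ _), AddCircle.coe_add, this]
  abel

theorem markedEvent_position {σ : Option (Fin (i + 1) ⊕ Fin (i + 1)) ↪ Fin n}
    {t : Fin n → UnitAddCircle} (hu : decodeGaps r (relPos σ t).1 = u)
    (c : Fin (i + 1) ⊕ Fin (i + 1)) :
    t (σ (some c)) = t (σ none) + ((gapHi u c - lag c * r : ℝ) : UnitAddCircle) := by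
  rw [decodeGaps, MeasurableEquiv.symm_apply_eq] at hu
  have := congrFun hu c
  rw [gapEquiv_apply] at this
  rw [← this]
  exact eq_add_coe_cwDist _ _ _

/-- Unmarked samples avoid the open gaps by definition; marked samples and the base point avoid them
by disjointness of the small gaps. -/
theorem isGapVector_of_markedEvent (hε : IsSep r i ε) (hq : IsDenom r i q)
    {σ : Option (Fin (i + 1) ⊕ Fin (i + 1)) ↪ Fin n} {t : Fin n → UnitAddCircle}
    (ht : t ∈ markedEvent r i q ε σ) :
    IsGapVector (pointSet t) r (t (σ none)) (decodeGaps r (relPos σ t).1) := by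
  obtain ⟨hu, harc⟩ := ht
  set u := decodeGaps r (relPos σ t).1 with hu'
  have hpos := markedEvent_position hu'.symm
  intro c
  have hlt : gapLo u c < gapHi u c := by
    rw [gapHi_eq]
    linarith [hu.2.1 c]
  refine ⟨?_, hlt, fun τ hτ hlo => ?_⟩
  · show _ ∈ pointSet t
    rw [← hpos]
    exact Finset.mem_image_of_mem _ (Finset.mem_univ _)
  · by_contra! hhi
    obtain ⟨a, -, ha⟩ := Finset.mem_image.1 (show _ ∈ Finset.univ.image t from hτ)
    have hmem : τ ∈ Set.Ioc (gapLo u c) (gapHi u c) := ⟨hlo, hhi.le⟩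
    by_cases har : a ∈ Set.range σ
    · obtain ⟨o, rfl⟩ := har
      rcases o with _ | c'
      · exact smallCone.coe_ne_zero hε hu hmem (by simpa using ha.symm)
      · rw [hpos c'] at ha
        have hlt' : gapLo u c' < gapHi u c' := by
          rw [gapHi_eq]
          linarith [hu.2.1 c']
        obtain ⟨rfl, h⟩ := smallCone.eq_of_mem hε hq hu hmem ⟨hlt', le_rfl⟩
          (add_left_cancel ha).symm
        exact hhi.ne h
    · refine harc ⟨a, har⟩ c ?_
      show cwDist _ (t a - t (σ none)) ∈ Set.Ioo _ _
      rw [cwDist_neg_eq ha ((smallCone.lo_nonneg hu c).trans hlo.le)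
        (by linarith [smallCone.hi_lt hu c, hε.lt_one])]
      exact ⟨hlo, hhi⟩

/-- Disjointness of the gaps makes the base point and all gap endpoints distinct, so choosing their
indices gives an embedding. -/
theorem exists_markedEvent (hε : IsSep r i ε) (hq : IsDenom r i q) {t : Fin n → UnitAddCircle}
    {b : Fin n} (hgap : IsGapVector (pointSet t) r (t b) u) (hu : u ∈ smallCone i q ε) :
    ∃ σ : Option (Fin (i + 1) ⊕ Fin (i + 1)) ↪ Fin n, σ none = b ∧ t ∈ markedEvent r i q ε σ := by
  have hex : ∀ c, ∃ a, t a = t b + ((gapHi u c - lag c * r : ℝ) : UnitAddCircle) := fun c => by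
    obtain ⟨a, -, ha⟩ := Finset.mem_image.1 (show _ ∈ Finset.univ.image t from (hgap c).1)
    exact ⟨a, ha⟩
  choose f hf using hex
  have hmem : ∀ c, gapHi u c ∈ Set.Ioc (gapLo u c) (gapHi u c) := fun c => ⟨(hgap c).2.1, le_rfl⟩
  have hfb : ∀ c, f c ≠ b := fun c h => by
    have := hf c
    rw [h] at this
    exact smallCone.coe_ne_zero hε hu (hmem c) (by simpa using this.symm)
  have hfi : Function.Injective f := fun c c' h => by
    have h1 := hf c
    rw [h, hf c'] at h1
    exact (smallCone.eq_of_mem hε hq hu (hmem c) (hmem c') (add_left_cancel h1).symm).1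
  let σ : Option (Fin (i + 1) ⊕ Fin (i + 1)) ↪ Fin n :=
    ⟨fun o => o.elim b f, by
      rintro (_ | c) (_ | c') h
      · rfl
      · exact absurd h.symm (hfb c')
      · exact absurd h (hfb c)
      · exact congrArg some (hfi h)⟩
  have hdec : decodeGaps r (relPos σ t).1 = u := by
    rw [decodeGaps, MeasurableEquiv.symm_apply_eq]
    ext c
    rw [gapEquiv_apply]
    exact cwDist_neg_eq (hf c) ((smallCone.lo_nonneg hu c).trans (hmem c).1.le)
      (by linarith [smallCone.hi_lt hu c, hε.lt_one])
  refine ⟨σ, rfl, ?_⟩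
  show _ ∧ _
  rw [hdec]
  refine ⟨hu, fun a c ha => ?_⟩
  have h1 : cwDist ((-(lag c * r) : ℝ) : UnitAddCircle) (t a - t b) ∈
      shiftSet (pointSet t) r (t b) (lag c) := by
    show _ ∈ pointSet t
    rw [← eq_add_coe_cwDist]
    exact Finset.mem_image_of_mem _ (Finset.mem_univ _)
  exact absurd ((hgap c).2.2 _ h1 ha.1) (not_le.2 ha.2)

/-- The base point determines its gap vector, hence all endpoints; counting labellings thus counts
base points without repetition. -/
theorem markedEvent_injOn (hε : IsSep r i ε) (hq : IsDenom r i q) {t : Fin n → UnitAddCircle}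
    (ht : Function.Injective t) {σ σ' : Option (Fin (i + 1) ⊕ Fin (i + 1)) ↪ Fin n}
    (h : t ∈ markedEvent r i q ε σ) (h' : t ∈ markedEvent r i q ε σ') (hb : σ none = σ' none) :
    σ = σ' := by
  have g := isGapVector_of_markedEvent hε hq h
  have g' := isGapVector_of_markedEvent hε hq h'
  rw [← hb] at g'
  have hu := g.unique g'
  ext o : 1
  rcases o with _ | c
  · exact hb
  · apply ht
    rw [markedEvent_position (σ := σ) hu c,
      markedEvent_position (σ := σ') (t := t) (r := r) rfl c, hb]

/-- The indices of the sample points at level `i`. -/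
def levelIdx (r : ℝ) (hr : 0 < r) (i : ℕ) (t : Fin n → UnitAddCircle) : Set (Fin n) :=
  {b | samplePt t b ∈ Set.range (cyclicMap (pointSet t) r hr)^[i] ∧
    samplePt t b ∉ Set.range (cyclicMap (pointSet t) r hr)^[i + 1]}

theorem samplePt_surjective (t : Fin n → UnitAddCircle) : Function.Surjective (samplePt t) := by
  rintro ⟨y, hy⟩
  obtain ⟨a, -, rfl⟩ := Finset.mem_image.1 (show y ∈ Finset.univ.image t from hy)
  exact ⟨a, rfl⟩

theorem lev_eq_ncard_levelIdx (hr : 0 < r) {t : Fin n → UnitAddCircle} (ht : Function.Injective t) :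
    lev (pointSet t) r hr i = (levelIdx r hr i t).ncard := by
  rw [lev_eq]
  refine (Set.ncard_preimage_of_injective_subset_range (f := samplePt t) ?_ ?_).symm
  · intro a b h
    exact ht (congrArg Subtype.val h)
  · rw [(samplePt_surjective t).range_eq]
    exact Set.subset_univ _

theorem card_markedEvent_le_lev (hr : 0 < r) (hr1 : r ≤ 1) (hε : IsSep r i ε) (hq : IsDenom r i q)
    {t : Fin n → UnitAddCircle} (ht : Function.Injective t) :
    (Finset.univ.filter fun σ => t ∈ markedEvent r i q ε σ).card ≤ lev (pointSet t) r hr i := by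
  rw [lev_eq_ncard_levelIdx hr ht, ← Set.ncard_coe_finset]
  refine Set.ncard_le_ncard_of_injOn (fun σ => σ none) ?_ ?_
  · intro σ hσ
    have h : t ∈ markedEvent r i q ε σ := by simpa using hσ
    exact (level_iff_mem_coneK hr hr1 (samplePt t (σ none)).2
      (isGapVector_of_markedEvent hε hq h)).2 h.1.1.1
  · intro σ hσ σ' hσ' hb
    exact markedEvent_injOn hε hq ht (by simpa using hσ) (by simpa using hσ') hb

/-- One of the arcs `[j / M, (j + 1) / M)` contains no sample point. -/
def sparseEvent (M n : ℕ) : Set (Fin n → UnitAddCircle) :=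
  {t | ∃ j < M, ∀ a, cwDist 0 (t a) ∉ Set.Ico ((j : ℝ) / M) ((j + 1) / M)}

theorem gap_le_of_notMem_sparseEvent {M : ℕ} (hM : 0 < M) {t : Fin n → UnitAddCircle}
    (ht : t ∉ sparseEvent M n) {x : UnitAddCircle} {k : ℕ} {s s' : ℝ}
    (h : IsNext (shiftSet (pointSet t) r x k) s s') : s' - s ≤ 2 / M := by
  have hM' : (0 : ℝ) < M := by exact_mod_cast hM
  set ξ := cwDist 0 x with hξ
  have hx : x = (ξ : UnitAddCircle) := by
    have := add_cwDist 0 x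
    rw [zero_add] at this
    exact this.symm
  set p := ξ - k * r + s with hp
  -- `J` indexes the first arc of the lifted grid starting strictly after `p`. A sample point in it
  -- lies ahead of `p` by at most two arc lengths.
  set J : ℤ := ⌊p * M⌋ + 1 with hJ
  have hJ1 : p * M < J := by
    rw [hJ]
    push_cast
    exact Int.lt_floor_add_one _
  have hJ2 : (J : ℝ) ≤ p * M + 1 := by
    rw [hJ]
    push_cast
    linarith [Int.floor_le (p * M)]
  have hM0 : (M : ℤ) ≠ 0 := by exact_mod_cast hM.ne'
  obtain ⟨j, hj⟩ : ∃ j : ℕ, (j : ℤ) = J % M :=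
    ⟨(J % M).toNat, Int.toNat_of_nonneg (Int.emod_nonneg _ hM0)⟩
  have hjM : j < M := by
    have := Int.emod_lt_of_pos J (show (0 : ℤ) < M by exact_mod_cast hM)
    omega
  have hdiv : (J : ℝ) = j + M * (J / M : ℤ) := by
    have := Int.emod_add_mul_ediv J M
    rw [← hj] at this
    exact_mod_cast this.symm
  simp only [sparseEvent, Set.mem_ofPred_eq, not_exists, not_and, not_forall, not_not] at ht
  obtain ⟨a, ha⟩ := ht j hjM
  set c := cwDist 0 (t a) with hc
  have hta : t a = (c : UnitAddCircle) := by
    have := add_cwDist 0 (t a)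
    rw [zero_add] at this
    exact this.symm
  have h1 : (j : ℝ) ≤ c * M := by rw [← div_le_iff₀ hM']; exact ha.1
  have h2 : c * M < j + 1 := by rw [← lt_div_iff₀ hM']; exact ha.2
  set τ := c + (J / M : ℤ) - ξ + k * r with hτ
  have hτmem : τ ∈ shiftSet (pointSet t) r x k := by
    have : x + ((τ - k * r : ℝ) : UnitAddCircle) = t a := by
      rw [hx, hta, ← AddCircle.coe_add, coe_eq_coe_iff_sub_int]
      exact ⟨J / M, by rw [hτ]; ring⟩
    show _ ∈ pointSet t
    rw [this]
    exact Finset.mem_image_of_mem _ (Finset.mem_univ _)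
  have e1 : (τ - s) * M = c * M + M * (J / M : ℤ) - p * M := by rw [hτ, hp]; ring
  have h3 : s < τ := by
    have : 0 < (τ - s) * M := by rw [e1]; linarith
    have := pos_of_mul_pos_left this hM'.le
    linarith
  have h4 := h.2.2 _ hτmem h3
  have h5 : τ - s ≤ 2 / M := by
    rw [le_div_iff₀ hM', e1]
    linarith
  linarith

theorem lev_le_card_markedEvent (hr : 0 < r) (hr1 : r ≤ 1) (hε : IsSep r i ε) (hq : IsDenom r i q)
    {t : Fin n → UnitAddCircle} (ht : Function.Injective t)
    (hgen : ∀ a b, t a + (r : UnitAddCircle) = t b → t a = t b)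
    {M : ℕ} (hM : 0 < M) (hMε : (2 * (i + 1) : ℝ) * (2 / M) < ε) (hs : t ∉ sparseEvent M n) :
    lev (pointSet t) r hr i ≤ (Finset.univ.filter fun σ => t ∈ markedEvent r i q ε σ).card := by
  rw [lev_eq_ncard_levelIdx hr ht, ← Set.ncard_coe_finset]
  have hsub : levelIdx r hr i t ⊆ (fun σ : Option (Fin (i + 1) ⊕ Fin (i + 1)) ↪ Fin n => σ none) ''
      (Finset.univ.filter fun σ => t ∈ markedEvent r i q ε σ : Finset _) := by
    intro b hb
    obtain ⟨u, hu⟩ := exists_isGapVector (i := i) ⟨t b, (samplePt t b).2⟩ r (t b)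
    have hK := (level_iff_mem_coneK hr hr1 (samplePt t b).2 hu).1 hb
    have hKq := mem_coneKq_of_mem_coneK hq (by
      rintro y hy z hz h
      obtain ⟨a, -, rfl⟩ := Finset.mem_image.1 (show y ∈ Finset.univ.image t from hy)
      obtain ⟨b, -, rfl⟩ := Finset.mem_image.1 (show z ∈ Finset.univ.image t from hz)
      exact hgen a b h) hu hK
    have hsmall : u ∈ smallCone i q ε := by
      refine ⟨hKq, hu.pos, lt_of_le_of_lt ?_ hMε⟩
      rw [l1Norm_eq hK.1]
      have : ∀ c ∈ Finset.univ, u c ≤ 2 / M := fun c _ => by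
        have := gap_le_of_notMem_sparseEvent hM hs (hu c)
        rw [gapHi_eq] at this
        linarith
      refine (Finset.sum_le_card_nsmul _ _ _ this).trans_eq ?_
      rw [nsmul_eq_mul, Finset.card_univ, Fintype.card_sum, Fintype.card_fin]
      push_cast
      ring
    obtain ⟨σ, rfl, hσ⟩ := exists_markedEvent hε hq hu hsmall
    exact ⟨σ, by simpa using hσ, rfl⟩
  exact (Set.ncard_le_ncard hsub (Set.toFinite _)).trans (Set.ncard_image_le (Set.toFinite _))

end Configurations

/-! ### Measurability -/

section Measurability

variable {i : ℕ}

theorem measurable_zSum (k : ℕ) : Measurable fun u : GapSpace i => zSum u k :=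
  Finset.measurable_sum _ fun _ _ => measurable_pi_apply _

theorem measurable_wSum (k : ℕ) : Measurable fun u : GapSpace i => wSum u k :=
  Finset.measurable_sum _ fun _ _ => measurable_pi_apply _

theorem measurable_l1Norm : Measurable fun u : GapSpace i => l1Norm u :=
  Finset.measurable_sum _ fun _ _ => continuous_abs.measurable.comp (measurable_pi_apply _)

theorem measurable_gapLo (c : Fin (i + 1) ⊕ Fin (i + 1)) :
    Measurable fun u : GapSpace i => gapLo u c := by
  rcases c with a | b
  · exact measurable_zSum _
  · exact measurable_wSum _

theorem measurable_gapHi (c : Fin (i + 1) ⊕ Fin (i + 1)) :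
    Measurable fun u : GapSpace i => gapHi u c := by
  rcases c with a | b
  · exact measurable_zSum _
  · exact measurable_wSum _

theorem measurable_gapIneq (j k : ℕ) : Measurable fun u : GapSpace i => gapIneq u j k :=
  measurableSet_setOfPred.1 (measurableSet_le (measurable_wSum k) (measurable_zSum j))

theorem measurableSet_coneK (i : ℕ) : MeasurableSet (coneK i) := by
  refine measurableSet_setOfPred.2 (Measurable.and ?_ (Measurable.and ?_ ?_))
  · exact Measurable.forall fun a => measurableSet_setOfPred.1
      (measurableSet_le measurable_const (measurable_pi_apply a))
  · exact Measurable.forall fun j => measurable_const.imp <| measurable_const.imp <|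
      measurable_gapIneq j j
  · exact (measurable_gapIneq _ _).not

theorem measurableSet_coneKq (i q : ℕ) : MeasurableSet (coneKq i q) :=
  measurableSet_setOfPred.2 <| Measurable.and (measurable_mem.2 (measurableSet_coneK i)) <|
    Measurable.forall fun j => Measurable.forall fun k => measurable_const.imp <|
      measurable_const.imp <| measurable_const.imp <| (measurable_gapIneq j k).not

theorem measurableSet_smallCone (i q : ℕ) (ε : ℝ) : MeasurableSet (smallCone i q ε) := by
  refine measurableSet_setOfPred.2 (Measurable.and
    (measurable_mem.2 (measurableSet_coneKq i q)) (Measurable.and ?_ ?_))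
  · exact Measurable.forall fun a => measurable_const.lt (measurable_pi_apply a)
  · exact measurable_l1Norm.lt measurable_const

theorem measurable_decodeGaps (r : ℝ) : Measurable (decodeGaps (i := i) r) :=
  (gapEquiv i).symm.measurable.comp <|
    measurable_pi_lambda _ fun c => measurable_cwDist measurable_const (measurable_pi_apply c)

theorem measurable_mem_gapArc {α : Type*} [MeasurableSpace α] {r : ℝ} {f : α → GapSpace i}
    {g : α → UnitAddCircle} (hf : Measurable f) (hg : Measurable g)
    (c : Fin (i + 1) ⊕ Fin (i + 1)) : Measurable fun a => g a ∈ gapArc r (f a) c :=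
  Measurable.and (((measurable_gapLo c).comp hf).lt (measurable_cwDist measurable_const hg))
    ((measurable_cwDist measurable_const hg).lt ((measurable_gapHi c).comp hf))

theorem measurableSet_config (r : ℝ) (i q : ℕ) (ε : ℝ) (κ : Type*) [Fintype κ] :
    MeasurableSet (config r i q ε κ) := by
  have h : Measurable fun p : (Fin (i + 1) ⊕ Fin (i + 1) → UnitAddCircle) × (κ → UnitAddCircle) =>
      decodeGaps r p.1 := (measurable_decodeGaps r).comp measurable_fst
  refine measurableSet_setOfPred.2 (Measurable.and
    (measurable_mem.2 (h (measurableSet_smallCone i q ε))) ?_)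
  exact Measurable.forall fun a => Measurable.forall fun c => Measurable.not <|
    measurable_mem_gapArc h ((measurable_pi_apply a).comp measurable_snd) c

variable {n : ℕ}

theorem measurable_relPos (σ : Option (Fin (i + 1) ⊕ Fin (i + 1)) ↪ Fin n) :
    Measurable (relPos σ) :=
  Measurable.prodMk
    (measurable_pi_lambda _ fun _ => (measurable_pi_apply _).sub (measurable_pi_apply _))
    (measurable_pi_lambda _ fun _ => (measurable_pi_apply _).sub (measurable_pi_apply _))

theorem measurableSet_markedEvent (r : ℝ) (i q : ℕ) (ε : ℝ)
    (σ : Option (Fin (i + 1) ⊕ Fin (i + 1)) ↪ Fin n) : MeasurableSet (markedEvent r i q ε σ) :=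
  measurable_relPos σ (measurableSet_config r i q ε _)

theorem measurable_samplePt_mem_range (r : ℝ) (hr : 0 < r) (k : ℕ) (b : Fin n) :
    Measurable fun t : Fin n → UnitAddCircle =>
      samplePt t b ∈ Set.range (cyclicMap (pointSet t) r hr)^[k] := by
  have hcw : ∀ a b : Fin n, Measurable fun t : Fin n → UnitAddCircle => cwDist (t a) (t b) :=
    fun a b => measurable_cwDist (measurable_pi_apply a) (measurable_pi_apply b)
  have hstep : ∀ a b : Fin n, Measurable fun t : Fin n → UnitAddCircle =>
      cyclicMap (pointSet t) r hr (samplePt t a) = samplePt t b := by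
    intro a b
    have : (fun t : Fin n → UnitAddCircle =>
        cyclicMap (pointSet t) r hr (samplePt t a) = samplePt t b) =
        fun t => cwDist (t a) (t b) < r ∧
          ∀ c, cwDist (t a) (t c) < r → cwDist (t a) (t c) ≤ cwDist (t a) (t b) := by
      funext t
      rw [cyclicMap_eq_iff, (samplePt_surjective t).forall]
      rfl
    rw [this]
    exact Measurable.and ((hcw a b).lt measurable_const) <| Measurable.forall fun c =>
      ((hcw a c).lt measurable_const).imp <|
        measurableSet_setOfPred.1 (measurableSet_le (hcw a c) (hcw a b))
  induction k generalizing b with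
  | zero => simp
  | succ k ih =>
    have : (fun t : Fin n → UnitAddCircle =>
        samplePt t b ∈ Set.range (cyclicMap (pointSet t) r hr)^[k + 1]) =
        fun t => ∃ a, samplePt t a ∈ Set.range (cyclicMap (pointSet t) r hr)^[k] ∧
          cyclicMap (pointSet t) r hr (samplePt t a) = samplePt t b := by
      funext t
      rw [Function.iterate_succ', Set.range_comp, Set.mem_image, (samplePt_surjective t).exists]
    rw [this]
    exact Measurable.exists fun a => (ih a).and (hstep a b)

/-! ### Generic samples -/

theorem volume_circle_pi_univ (κ : Type*) [Fintype κ] :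
    (volume : Measure (κ → UnitAddCircle)) Set.univ = 1 := by
  rw [volume_pi, Measure.pi_univ]
  simp

/-- The difference of two coordinates is a continuous surjective homomorphism, so it is uniformly
distributed and has no atoms. -/
theorem ae_sub_ne {a b : Fin n} (hab : a ≠ b) (x : UnitAddCircle) :
    ∀ᵐ t : Fin n → UnitAddCircle, t a - t b ≠ x := by
  let φ : (Fin n → UnitAddCircle) →+ UnitAddCircle :=
    Pi.evalAddMonoidHom (fun _ => UnitAddCircle) a - Pi.evalAddMonoidHom (fun _ => UnitAddCircle) b
  have hφ : ∀ t, φ t = t a - t b := fun t => rfl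
  have hmp : MeasurePreserving φ volume volume := by
    refine AddMonoidHom.measurePreserving ?_ ?_ (by simp [volume_circle_pi_univ])
    · exact (continuous_apply a).sub (continuous_apply b)
    · intro y
      refine ⟨Pi.single a y, ?_⟩
      simp [hφ, Pi.single_eq_of_ne hab.symm]
  have h0 : ∀ᵐ y : UnitAddCircle, y ≠ x := by
    have hnull : (volume : Measure UnitAddCircle) {x} = 0 := by
      have := (measurePreserving_cwDist x).measure_preimage
        (MeasurableSet.singleton (0 : ℝ)).nullMeasurableSet
      have h2 : cwDist x ⁻¹' {0} = {x} := by
        ext y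
        simp only [Set.mem_preimage, Set.mem_singleton_iff]
        rw [← cwDist_self x]
        exact (cwDist_injective x).eq_iff
      rw [h2] at this
      rw [this]
      exact Measure.restrict_le_self.absolutelyContinuous (by simp)
    simpa [ae_iff] using hnull
  exact hmp.quasiMeasurePreserving.ae h0

theorem ae_injective (n : ℕ) : ∀ᵐ t : Fin n → UnitAddCircle, Function.Injective t := by
  have : ∀ᵐ t : Fin n → UnitAddCircle, ∀ a b : Fin n, a ≠ b → t a - t b ≠ 0 := by
    rw [ae_all_iff]
    intro a
    rw [ae_all_iff]
    intro b
    by_cases h : a = b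
    · simp [h]
    · filter_upwards [ae_sub_ne h 0] with t ht _ using ht
  filter_upwards [this] with t ht a b hab
  by_contra hne
  exact ht a b hne (sub_eq_zero.2 hab)

theorem ae_generic (n : ℕ) (r : ℝ) :
    ∀ᵐ t : Fin n → UnitAddCircle, ∀ a b, t a + (r : UnitAddCircle) = t b → t a = t b := by
  rw [ae_all_iff]
  intro a
  rw [ae_all_iff]
  intro b
  by_cases h : a = b
  · simp [h]
  · filter_upwards [ae_sub_ne h (-(r : UnitAddCircle))] with t ht h1
    exact absurd (by rw [← h1]; abel) ht

/-- Counting indices instead of points is measurable, and the two counts agree on injective samples.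
-/
theorem aemeasurable_lev (n : ℕ) (r : ℝ) (hr : 0 < r) (i : ℕ) :
    AEMeasurable fun t : Fin n → UnitAddCircle => (lev (pointSet t) r hr i : ℝ) := by
  have hL : ∀ b, Measurable fun t : Fin n → UnitAddCircle => b ∈ levelIdx r hr i t := fun b =>
    (measurable_samplePt_mem_range r hr i b).and (measurable_samplePt_mem_range r hr (i + 1) b).not
  refine ⟨fun t => ∑ b, if b ∈ levelIdx r hr i t then 1 else 0, ?_, ?_⟩
  · exact Finset.measurable_sum _ fun b _ =>
      Measurable.ite (measurableSet_setOfPred.2 (hL b)) measurable_const measurable_const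
  · filter_upwards [ae_injective n] with t ht
    rw [lev_eq_ncard_levelIdx hr ht, Set.ncard_eq_toFinset_card']
    simp [Set.toFinset]

theorem lev_le (n : ℕ) (r : ℝ) (hr : 0 < r) (i : ℕ) (t : Fin n → UnitAddCircle) :
    lev (pointSet t) r hr i ≤ n := by
  calc lev (pointSet t) r hr i ≤ Nat.card (pointSet t) := Set.ncard_le_card _
    _ = (pointSet t).card := by simp
    _ ≤ _ := Finset.card_image_le.trans_eq (by simp)

end Measurability

/-! ### The probability of a marked event -/

section Probability

variable {i n : ℕ}

/-- A continuous surjective homomorphism of compact groups carries normalised Haar measure to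
normalised Haar measure. A preimage is obtained by putting the base point at 0. -/
theorem measurePreserving_relPos (σ : Option (Fin (i + 1) ⊕ Fin (i + 1)) ↪ Fin n) :
    MeasurePreserving (relPos σ) volume volume := by
  have : BorelSpace ((Fin (i + 1) ⊕ Fin (i + 1) → UnitAddCircle) ×
      ({a : Fin n // a ∉ Set.range σ} → UnitAddCircle)) := Prod.borelSpace
  have : ((volume : Measure (Fin (i + 1) ⊕ Fin (i + 1) → UnitAddCircle)).prod
      (volume : Measure ({a : Fin n // a ∉ Set.range σ} → UnitAddCircle))).IsAddHaarMeasure :=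
    Measure.prod.instIsAddHaarMeasure _ _
  rw [Measure.volume_eq_prod]
  refine AddMonoidHom.measurePreserving ?_ ?_ ?_
  · exact Continuous.prodMk
      (continuous_pi fun _ => (continuous_apply _).sub (continuous_apply _))
      (continuous_pi fun _ => (continuous_apply _).sub (continuous_apply _))
  · rintro ⟨v, w⟩
    let t : Fin n → UnitAddCircle := fun a =>
      if h : a ∈ Set.range σ then (Classical.choose h).elim 0 v else w ⟨a, h⟩
    have ht : ∀ o, t (σ o) = o.elim 0 v := fun o => by
      have h : σ o ∈ Set.range σ := ⟨o, rfl⟩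
      simp only [t, dif_pos h]
      rw [σ.injective (Classical.choose_spec h)]
    refine ⟨t, Prod.ext ?_ ?_⟩
    · ext c
      show t (σ (some c)) - t (σ none) = v c
      simp [ht]
    · ext a
      show t a - t (σ none) = w a
      rw [ht]
      simp only [t, dif_neg a.2]
      simp
  · rw [volume_circle_pi_univ, ← Set.univ_prod_univ, Measure.prod_prod,
      volume_circle_pi_univ, volume_circle_pi_univ, one_mul]

variable {r : ℝ} {q : ℕ} {ε : ℝ}

theorem volume_gapArc {u : GapSpace i} (hu : u ∈ smallCone i q ε) (hε : ε < 1)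
    (c : Fin (i + 1) ⊕ Fin (i + 1)) : volume (gapArc r u c) = ENNReal.ofReal (u c) := by
  have h := (measurePreserving_cwDist ((-(lag c * r) : ℝ) : UnitAddCircle)).measure_preimage
    (measurableSet_Ioo (a := gapLo u c) (b := gapHi u c)).nullMeasurableSet
  refine h.trans ?_
  rw [Measure.restrict_apply measurableSet_Ioo, Set.inter_eq_left.2, Real.volume_Ioo, gapHi_eq,
    add_sub_cancel_left]
  intro y hy
  exact ⟨(smallCone.lo_nonneg hu c).trans hy.1.le, by linarith [hy.2, smallCone.hi_lt hu c]⟩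

theorem measurableSet_gapArc (r : ℝ) (u : GapSpace i) (c : Fin (i + 1) ⊕ Fin (i + 1)) :
    MeasurableSet (gapArc r u c) :=
  measurableSet_setOfPred.2 (measurable_mem_gapArc measurable_const measurable_id c)

theorem volume_compl_iUnion_gapArc (hε : IsSep r i ε) (hq : IsDenom r i q) {u : GapSpace i}
    (hu : u ∈ smallCone i q ε) :
    volume (⋃ c, gapArc r u c)ᶜ = ENNReal.ofReal (1 - l1Norm u) := by
  have hdisj : Pairwise (Function.onFun Disjoint (gapArc r u)) := by
    intro c c' hne
    refine Set.disjoint_left.2 fun y hy hy' => hne ?_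
    refine (smallCone.eq_of_mem hε hq hu ⟨hy.1, hy.2.le⟩ ⟨hy'.1, hy'.2.le⟩ ?_).1
    have h1 := eq_add_coe_cwDist 0 y (lag c * r)
    have h2 := eq_add_coe_cwDist 0 y (lag c' * r)
    simp only [sub_zero, zero_add] at h1 h2
    exact h1.symm.trans h2
  rw [measure_compl (MeasurableSet.iUnion fun c => measurableSet_gapArc r u c) (measure_ne_top _ _),
    measure_iUnion hdisj fun c => measurableSet_gapArc r u c, tsum_fintype,
    UnitAddCircle.measure_univ]
  simp_rw [volume_gapArc hu hε.lt_one]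
  rw [← ENNReal.ofReal_sum_of_nonneg fun c _ => (hu.2.1 c).le, ← l1Norm_eq fun c => (hu.2.1 c).le,
    ENNReal.ofReal_sub _ (show 0 ≤ l1Norm u from Finset.sum_nonneg fun _ _ => abs_nonneg _),
    ENNReal.ofReal_one]

/-- Clockwise distances are uniform on the unit cube and the passage to gaps has determinant 1.
Small gaps have all endpoints inside the cube, so the restriction to it can be dropped. -/
theorem lintegral_decodeGaps (hε : ε < 1) {F : GapSpace i → ENNReal} (hF : Measurable F)
    (hsupp : ∀ u, u ∉ smallCone i q ε → F u = 0) :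
    ∫⁻ v : Fin (i + 1) ⊕ Fin (i + 1) → UnitAddCircle, F (decodeGaps r v) = ∫⁻ u, F u := by
  have h1 : MeasurePreserving
      (fun (v : Fin (i + 1) ⊕ Fin (i + 1) → UnitAddCircle) c =>
        cwDist ((-(lag c * r) : ℝ) : UnitAddCircle) (v c)) volume
      (volume.restrict (Set.univ.pi fun _ : Fin (i + 1) ⊕ Fin (i + 1) => Set.Ico (0 : ℝ) 1)) := by
    rw [volume_pi, volume_pi, Measure.restrict_pi_pi]
    exact measurePreserving_pi _ _ fun c => measurePreserving_cwDist _
  have h2 := h1.lintegral_comp (hF.comp (gapEquiv i).symm.measurable)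
  refine h2.trans ?_
  have h3 : ∀ V : GapSpace i,
      V ∉ (Set.univ.pi fun _ : Fin (i + 1) ⊕ Fin (i + 1) => Set.Ico (0 : ℝ) 1) →
      (F ∘ (gapEquiv i).symm) V = 0 := by
    intro V hV
    refine hsupp _ fun hu => hV fun c _ => ?_
    have h4 : V c = gapHi ((gapEquiv i).symm V) c := by
      rw [← gapEquiv_apply, MeasurableEquiv.apply_symm_apply]
    have h5 := smallCone.lo_nonneg hu c
    have h6 := smallCone.hi_lt hu c
    have h7 := gapHi_eq ((gapEquiv i).symm V) c
    have h8 := hu.2.1 c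
    exact ⟨by rw [h4]; linarith, by rw [h4]; linarith⟩
  rw [setLIntegral_eq_of_support_subset (Function.support_subset_iff'.2 h3)]
  exact (measurePreserving_gapEquiv.symm _).lintegral_comp hF

/-- Conditionally on the marked positions, the remaining n-(2i+3) samples independently avoid
disjoint arcs of total length ‖u‖. -/
theorem volume_markedEvent (hε : IsSep r i ε) (hq : IsDenom r i q)
    (σ : Option (Fin (i + 1) ⊕ Fin (i + 1)) ↪ Fin n) :
    volume (markedEvent r i q ε σ) =
      ∫⁻ u in smallCone i q ε, ENNReal.ofReal (1 - l1Norm u) ^ (n - (2 * i + 3)) := by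
  have hcard : Fintype.card {a : Fin n // a ∉ Set.range σ} = n - (2 * i + 3) := by
    rw [Fintype.card_subtype_compl, Fintype.card_fin]
    have := Set.card_range_of_injective σ.injective
    simp only [Fintype.card_option, Fintype.card_sum, Fintype.card_fin] at this
    have h2 : Fintype.card {a // a ∈ Set.range σ} = i + 1 + (i + 1) + 1 :=
      (Fintype.card_congr (Equiv.refl _)).trans this
    omega
  have hslice : ∀ v : Fin (i + 1) ⊕ Fin (i + 1) → UnitAddCircle,
      volume (Prod.mk v ⁻¹' config r i q ε {a : Fin n // a ∉ Set.range σ}) =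
      (smallCone i q ε).indicator
        (fun u => ENNReal.ofReal (1 - l1Norm u) ^ (n - (2 * i + 3))) (decodeGaps r v) := by
    intro v
    by_cases hv : decodeGaps r v ∈ smallCone i q ε
    · have : Prod.mk v ⁻¹' config r i q ε {a : Fin n // a ∉ Set.range σ} =
          Set.univ.pi fun _ => (⋃ c, gapArc r (decodeGaps r v) c)ᶜ := by
        ext w
        simp [config, hv]
      rw [this, volume_pi, Measure.pi_pi, Set.indicator_of_mem hv, Finset.prod_const,
        Finset.card_univ, hcard, volume_compl_iUnion_gapArc hε hq hv]
    · have : Prod.mk v ⁻¹' config r i q ε {a : Fin n // a ∉ Set.range σ} = ∅ := by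
        ext w
        simp [config, hv]
      rw [this, measure_empty, Set.indicator_of_notMem hv]
  rw [markedEvent, (measurePreserving_relPos σ).measure_preimage
    (measurableSet_config r i q ε _).nullMeasurableSet, Measure.volume_eq_prod,
    Measure.prod_apply (measurableSet_config r i q ε _)]
  simp_rw [hslice]
  rw [lintegral_decodeGaps hε.lt_one ?_ fun u hu => Set.indicator_of_notMem hu _,
    lintegral_indicator (measurableSet_smallCone i q ε)]
  exact Measurable.indicator
    (((measurable_const.sub measurable_l1Norm).ennreal_ofReal).pow_const _)
    (measurableSet_smallCone i q ε)

theorem volume_sparseEvent_le {M : ℕ} (hM : 0 < M) (n : ℕ) :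
    volume (sparseEvent M n) ≤ M * ENNReal.ofReal (1 - 1 / M) ^ n := by
  have hM' : (0 : ℝ) < M := by exact_mod_cast hM
  have hsub : sparseEvent M n ⊆ ⋃ j ∈ Finset.range M, Set.univ.pi fun _ : Fin n =>
      (cwDist 0 ⁻¹' Set.Ico ((j : ℝ) / M) ((j + 1) / M))ᶜ := by
    rintro t ⟨j, hj, ht⟩
    simp only [Set.mem_iUnion]
    exact ⟨j, Finset.mem_range.2 hj, fun a _ => ht a⟩
  refine (measure_mono hsub).trans ((measure_biUnion_finset_le _ _).trans ?_)
  have hone : ∀ j ∈ Finset.range M, volume (Set.univ.pi fun _ : Fin n =>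
      (cwDist 0 ⁻¹' Set.Ico ((j : ℝ) / M) ((j + 1) / M))ᶜ) = ENNReal.ofReal (1 - 1 / M) ^ n := by
    intro j hj
    have hjM : (j : ℝ) + 1 ≤ M := by exact_mod_cast Finset.mem_range.1 hj
    have hmp := measurePreserving_cwDist 0
    rw [volume_pi, Measure.pi_pi, Finset.prod_const, Finset.card_univ, Fintype.card_fin,
      measure_compl (hmp.measurable measurableSet_Ico) (measure_ne_top _ _),
      hmp.measure_preimage measurableSet_Ico.nullMeasurableSet,
      Measure.restrict_apply measurableSet_Ico, Set.inter_eq_left.2, Real.volume_Ico,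
      UnitAddCircle.measure_univ, ← ENNReal.ofReal_one, ← ENNReal.ofReal_sub]
    · congr 3
      field_simp
      ring
    · rw [sub_nonneg]
      gcongr
      linarith
    · exact Set.Ico_subset_Ico (by positivity) ((div_le_one hM').2 hjM)
  rw [Finset.sum_congr rfl hone, Finset.sum_const, Finset.card_range, nsmul_eq_mul]

theorem measurableSet_sparseEvent (M n : ℕ) : MeasurableSet (sparseEvent M n) :=
  measurableSet_setOfPred.2 <| Measurable.exists fun _ => measurable_const.and <|
    Measurable.forall fun a => Measurable.not <| measurable_mem.2 <|
      (measurable_cwDist measurable_const (measurable_pi_apply a)) measurableSet_Ico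

end Probability

/-! ### Asymptotics of the expected number of marked events -/

section Asymptotics

variable {i : ℕ}

theorem zSum_smul (a : ℝ) (u : GapSpace i) (k : ℕ) : zSum (a • u) k = a * zSum u k := by
  simp [zSum, Finset.mul_sum]

theorem wSum_smul (a : ℝ) (u : GapSpace i) (k : ℕ) : wSum (a • u) k = a * wSum u k := by
  simp [wSum, Finset.mul_sum]

theorem l1Norm_smul {a : ℝ} (ha : 0 ≤ a) (u : GapSpace i) : l1Norm (a • u) = a * l1Norm u := by
  simp [l1Norm, abs_mul, abs_of_nonneg ha, mul_add, Finset.mul_sum]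

theorem l1Norm_nonneg (u : GapSpace i) : 0 ≤ l1Norm u := Finset.sum_nonneg fun _ _ => abs_nonneg _

theorem gapIneq_smul {a : ℝ} (ha : 0 < a) (u : GapSpace i) (j k : ℕ) :
    gapIneq (a • u) j k ↔ gapIneq u j k := by
  rw [gapIneq, gapIneq, zSum_smul, wSum_smul, ge_iff_le, ge_iff_le, mul_le_mul_iff_right₀ ha]

theorem smul_mem_coneKq {a : ℝ} (ha : 0 < a) (q : ℕ) (u : GapSpace i) :
    a • u ∈ coneKq i q ↔ u ∈ coneKq i q := by
  simp only [coneKq, coneK, Set.mem_ofPred_eq, gapIneq_smul ha, Pi.smul_apply, smul_eq_mul,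
    mul_nonneg_iff_of_pos_left ha]

/-- The part of `coneKq i q` with positive coordinates. -/
def posCone (i q : ℕ) : Set (GapSpace i) :=
  {u | u ∈ coneKq i q ∧ ∀ c, 0 < u c}

theorem measurableSet_posCone (i q : ℕ) : MeasurableSet (posCone i q) :=
  measurableSet_setOfPred.2 <| Measurable.and (measurable_mem.2 (measurableSet_coneKq i q)) <|
    Measurable.forall fun a => measurable_const.lt (measurable_pi_apply a)

theorem posCone_ae_eq (i q : ℕ) : posCone i q =ᵐ[volume] coneKq i q := by
  have h : ∀ᵐ u : GapSpace i, ∀ c, u c ≠ 0 := by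
    rw [ae_all_iff]
    intro c
    exact Measure.ae_eval_ne _ c 0
  filter_upwards [h] with u hu
  refine propext ⟨fun h => h.1, fun h => ⟨h, fun c => lt_of_le_of_ne (h.1.1 c) (hu c).symm⟩⟩

theorem mem_smallCone_iff {q : ℕ} {ε : ℝ} {u : GapSpace i} :
    u ∈ smallCone i q ε ↔ u ∈ posCone i q ∧ l1Norm u < ε := and_assoc.symm

theorem smul_mem_posCone {a : ℝ} (ha : 0 < a) (q : ℕ) (u : GapSpace i) :
    a • u ∈ posCone i q ↔ u ∈ posCone i q := by
  simp only [posCone, Set.mem_ofPred_eq, smul_mem_coneKq ha, Pi.smul_apply, smul_eq_mul,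
    mul_pos_iff_of_pos_left ha]

theorem integrable_posCone_exp (i q : ℕ) :
    Integrable ((posCone i q).indicator fun u => Real.exp (-(1 / 2) * l1Norm u)) := by
  have h1 : Integrable (fun u : GapSpace i =>
      ∏ c, (Set.Ioi (0 : ℝ)).indicator (fun x => Real.exp (-(1 / 2) * x)) (u c)) := by
    refine Integrable.fintype_prod
      (f := fun _ x => (Set.Ioi (0 : ℝ)).indicator (fun x => Real.exp (-(1 / 2) * x)) x) fun _ => ?_
    rw [integrable_indicator_iff measurableSet_Ioi]
    exact exp_neg_integrableOn_Ioi 0 (by norm_num)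
  refine (h1.indicator (measurableSet_posCone i q)).congr (Eventually.of_forall fun u => ?_)
  by_cases hu : u ∈ posCone i q
  · rw [Set.indicator_of_mem hu, Set.indicator_of_mem hu, l1Norm_eq fun c => (hu.2 c).le,
      Finset.mul_sum, Real.exp_sum]
    exact Finset.prod_congr rfl fun c _ => Set.indicator_of_mem (hu.2 c) _
  · rw [Set.indicator_of_notMem hu, Set.indicator_of_notMem hu]

theorem tendsto_one_sub_div_pow_sub (s : ℝ) (c : ℕ) :
    Tendsto (fun n : ℕ => (1 - s / n) ^ (n - c)) atTop (𝓝 (Real.exp (-s))) := by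
  have h1 := Real.tendsto_one_add_div_pow_exp (-s)
  have h0 : Tendsto (fun n : ℕ => 1 - s / (n : ℝ)) atTop (𝓝 1) := by
    simpa using (tendsto_const_div_atTop_nhds_zero_nat s).const_sub 1
  have h2 := h1.div (h0.pow c) (by simp)
  rw [one_pow, div_one] at h2
  refine h2.congr' ?_
  filter_upwards [h0.eventually_ne one_ne_zero, eventually_ge_atTop c] with n hn hc
  rw [Pi.div_apply, div_eq_iff (pow_ne_zero _ hn), ← pow_add, Nat.sub_add_cancel hc, neg_div,
    sub_eq_add_neg]

theorem one_sub_div_pow_le {s : ℝ} (hs : 0 ≤ s) {n c : ℕ} (hn : 2 * c ≤ n) (h0 : 0 < n)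
    (hsn : s ≤ n) : (1 - s / n) ^ (n - c) ≤ Real.exp (-(1 / 2) * s) := by
  have hn' : (0 : ℝ) < n := by exact_mod_cast h0
  have h1 : 1 - s / n ≤ Real.exp (-(s / n)) := Real.one_sub_le_exp_neg _
  have h2 : 0 ≤ 1 - s / n := by
    rw [sub_nonneg, div_le_one hn']
    exact hsn
  refine (pow_le_pow_left₀ h2 h1 _).trans ?_
  rw [← Real.exp_nat_mul, Real.exp_le_exp, Nat.cast_sub (by omega)]
  have h3 : (2 : ℝ) * c ≤ n := by exact_mod_cast hn
  have h4 : (1 / 2 : ℝ) ≤ (n - c) / n := by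
    rw [le_div_iff₀ hn']
    linarith
  have h5 := mul_le_mul_of_nonneg_right h4 hs
  have h6 : ((n : ℝ) - c) * -(s / n) = -((n - c) / n * s) := by ring
  rw [h6]
  linarith

/-- Substituting u = v/n yields the factor n^{-(2i+2)}, which balances the falling factorial divided
by n. The cone is scale invariant, the cutoff ‖v‖ < εn disappears, and exp(-‖v‖/2) dominates because
the exponent is eventually at least n/2. -/
theorem tendsto_descFactorial_mul_integral {q : ℕ} {ε : ℝ} (hε : 0 < ε) (hε1 : ε < 1) :
    Tendsto (fun n : ℕ => (n.descFactorial (2 * i + 3) : ℝ) / n *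
      ∫ u in smallCone i q ε, (1 - l1Norm u) ^ (n - (2 * i + 3))) atTop
      (𝓝 (∫ u in coneKq i q, Real.exp (-l1Norm u))) := by
  have hdom : Tendsto (fun n : ℕ => ∫ v : GapSpace i, (smallCone i q ε).indicator
      (fun u => (1 - l1Norm u) ^ (n - (2 * i + 3))) ((n : ℝ)⁻¹ • v)) atTop
      (𝓝 (∫ v, (posCone i q).indicator (fun v => Real.exp (-l1Norm v)) v)) := by
    refine tendsto_integral_filter_of_dominated_convergence
      ((posCone i q).indicator fun u => Real.exp (-(1 / 2) * l1Norm u)) ?_ ?_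
      (integrable_posCone_exp i q) ?_
    · refine Eventually.of_forall fun n => Measurable.aestronglyMeasurable ?_
      exact (Measurable.indicator ((measurable_const.sub measurable_l1Norm).pow_const _)
        (measurableSet_smallCone i q ε)).comp (measurable_const_smul _)
    · filter_upwards [eventually_ge_atTop (2 * (2 * i + 3))] with n hn
      have h0 : 0 < n := by omega
      have hn' : (0 : ℝ) < n := by exact_mod_cast h0
      refine Eventually.of_forall fun v => ?_
      by_cases hv : (n : ℝ)⁻¹ • v ∈ smallCone i q ε
      · have hv2 := hv
        rw [mem_smallCone_iff, smul_mem_posCone (inv_pos.2 hn'),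
          l1Norm_smul (inv_pos.2 hn').le] at hv2
        rw [Set.indicator_of_mem hv, Set.indicator_of_mem hv2.1, l1Norm_smul (inv_pos.2 hn').le,
          ← div_eq_inv_mul]
        have h1 : l1Norm v / n < 1 := by
          rw [div_eq_inv_mul]
          linarith [hv2.2]
        rw [Real.norm_of_nonneg (pow_nonneg (by linarith) _)]
        exact one_sub_div_pow_le (l1Norm_nonneg v) hn h0 ((div_lt_one hn').1 h1).le
      · rw [Set.indicator_of_notMem hv, norm_zero]
        exact Set.indicator_nonneg (fun _ _ => (Real.exp_pos _).le) _
    · refine Eventually.of_forall fun v => ?_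
      by_cases hv : v ∈ posCone i q
      · rw [Set.indicator_of_mem hv]
        refine (tendsto_one_sub_div_pow_sub (l1Norm v) (2 * i + 3)).congr' ?_
        have h1 : ∀ᶠ n : ℕ in atTop, l1Norm v / n < ε :=
          (tendsto_const_div_atTop_nhds_zero_nat _).eventually_lt_const hε
        filter_upwards [h1, eventually_gt_atTop 0] with n hn h0
        have hn' : (0 : ℝ) < n := by exact_mod_cast h0
        rw [Set.indicator_of_mem, l1Norm_smul (inv_pos.2 hn').le, ← div_eq_inv_mul]
        rw [mem_smallCone_iff, smul_mem_posCone (inv_pos.2 hn'), l1Norm_smul (inv_pos.2 hn').le,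
          ← div_eq_inv_mul]
        exact ⟨hv, hn⟩
      · rw [Set.indicator_of_notMem hv]
        refine tendsto_const_nhds.congr' ?_
        filter_upwards [eventually_gt_atTop 0] with n h0
        have hn' : (0 : ℝ) < n := by exact_mod_cast h0
        rw [Set.indicator_of_notMem]
        rw [mem_smallCone_iff, smul_mem_posCone (inv_pos.2 hn')]
        exact fun h => hv h.1
  rw [integral_indicator (measurableSet_posCone i q),
    setIntegral_congr_set (posCone_ae_eq i q)] at hdom
  have hdesc : Tendsto (fun n : ℕ => (n.descFactorial (2 * i + 3) : ℝ) / n ^ (2 * i + 3)) atTop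
      (𝓝 1) := by
    refine (Asymptotics.isEquivalent_iff_tendsto_one ?_).1 (isEquivalent_descFactorial (2 * i + 3))
    filter_upwards [eventually_gt_atTop 0] with n h0
    positivity
  have := hdesc.mul hdom
  rw [one_mul] at this
  refine this.congr' ?_
  filter_upwards [eventually_gt_atTop 0] with n h0
  have hn' : (0 : ℝ) < n := by exact_mod_cast h0
  rw [Measure.integral_comp_inv_smul_of_nonneg _ _ hn'.le, integral_indicator
    (measurableSet_smallCone i q ε)]
  have hd : Module.finrank ℝ (GapSpace i) = 2 * i + 2 := by
    rw [Module.finrank_fintype_fun_eq_card, Fintype.card_sum, Fintype.card_fin]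
    ring
  rw [hd, smul_eq_mul, show 2 * i + 3 = (2 * i + 2) + 1 by ring, pow_succ (n : ℝ)]
  field_simp

/-! ### The expectation of the number of points at a level -/

variable {n : ℕ} {r : ℝ} {q : ℕ} {ε : ℝ}

theorem isProbabilityMeasure_circle_pi (κ : Type*) [Fintype κ] :
    IsProbabilityMeasure (volume : Measure (κ → UnitAddCircle)) :=
  ⟨volume_circle_pi_univ κ⟩

theorem measureReal_markedEvent (hε : IsSep r i ε) (hq : IsDenom r i q)
    (σ : Option (Fin (i + 1) ⊕ Fin (i + 1)) ↪ Fin n) :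
    volume.real (markedEvent r i q ε σ) =
      ∫ u in smallCone i q ε, (1 - l1Norm u) ^ (n - (2 * i + 3)) := by
  have h : ∀ u ∈ smallCone i q ε, 0 ≤ 1 - l1Norm u := fun u hu => by
    linarith [hu.2.2, hε.lt_one]
  rw [measureReal_def, volume_markedEvent hε hq, integral_eq_lintegral_of_nonneg_ae]
  · congr 1
    refine setLIntegral_congr_fun (measurableSet_smallCone i q ε) fun u hu => ?_
    exact (ENNReal.ofReal_pow (h u hu) _).symm
  · filter_upwards [ae_restrict_mem (measurableSet_smallCone i q ε)] with u hu
    exact pow_nonneg (h u hu) _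
  · exact ((measurable_const.sub measurable_l1Norm).pow_const _).aestronglyMeasurable

theorem integrable_lev (n : ℕ) (r : ℝ) (hr : 0 < r) (i : ℕ) :
    Integrable fun t : Fin n → UnitAddCircle => (lev (pointSet t) r hr i : ℝ) := by
  have := isProbabilityMeasure_circle_pi (Fin n)
  refine Integrable.of_bound (aemeasurable_lev n r hr i).aestronglyMeasurable n
    (Eventually.of_forall fun t => ?_)
  rw [Real.norm_natCast]
  exact_mod_cast lev_le n r hr i t

/-- Almost surely the number of labellings is at most the level count, with equality off the sparse
event; on that event the discrepancy is at most `n`. -/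
theorem abs_integral_lev_sub_le (hr : 0 < r) (hr1 : r ≤ 1) (hε : IsSep r i ε) (hq : IsDenom r i q)
    {M : ℕ} (hM : 0 < M) (hMε : (2 * (i + 1) : ℝ) * (2 / M) < ε) (n : ℕ) :
    |(∫ t : Fin n → UnitAddCircle, (lev (pointSet t) r hr i : ℝ)) - n.descFactorial (2 * i + 3) *
      ∫ u in smallCone i q ε, (1 - l1Norm u) ^ (n - (2 * i + 3))| ≤
      n * (M * (1 - 1 / M) ^ n) := by
  have := isProbabilityMeasure_circle_pi (Fin n)
  set h : (Fin n → UnitAddCircle) → ℝ := fun t =>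
    ∑ σ : Option (Fin (i + 1) ⊕ Fin (i + 1)) ↪ Fin n, (markedEvent r i q ε σ).indicator 1 t with hh
  have hcard : ∀ t, h t = ((Finset.univ.filter fun σ => t ∈ markedEvent r i q ε σ).card : ℝ) := by
    intro t
    simp [hh, Set.indicator_apply]
  have hint1 : ∀ σ : Option (Fin (i + 1) ⊕ Fin (i + 1)) ↪ Fin n,
      Integrable ((markedEvent r i q ε σ).indicator (1 : (Fin n → UnitAddCircle) → ℝ)) := fun σ =>
    (integrable_const (1 : ℝ)).indicator (measurableSet_markedEvent r i q ε σ)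
  have hint : Integrable h := integrable_finsetSum _ fun σ _ => hint1 σ
  have hval : ∫ t, h t = n.descFactorial (2 * i + 3) *
      ∫ u in smallCone i q ε, (1 - l1Norm u) ^ (n - (2 * i + 3)) := by
    rw [hh, integral_finsetSum _ fun σ _ => hint1 σ]
    simp_rw [integral_indicator_one (measurableSet_markedEvent r i q ε _),
      measureReal_markedEvent hε hq]
    rw [Finset.sum_const, Finset.card_univ, Fintype.card_embedding_eq, nsmul_eq_mul,
      Fintype.card_fin, Fintype.card_option, Fintype.card_sum, Fintype.card_fin,
      show i + 1 + (i + 1) + 1 = 2 * i + 3 by ring]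
  have hsparse : Integrable ((sparseEvent M n).indicator fun _ => (n : ℝ)) :=
    (integrable_const (n : ℝ)).indicator (measurableSet_sparseEvent M n)
  have hlev := integrable_lev n r hr i
  have hM1 : (0 : ℝ) ≤ 1 - 1 / M := by
    rw [sub_nonneg, div_le_one (by exact_mod_cast hM)]
    exact_mod_cast hM
  have hprob : volume.real (sparseEvent M n) ≤ M * (1 - 1 / M) ^ n := by
    refine ENNReal.toReal_le_of_le_ofReal (by positivity) ?_
    refine (volume_sparseEvent_le hM n).trans_eq ?_
    rw [ENNReal.ofReal_mul (by positivity), ENNReal.ofReal_pow hM1, ENNReal.ofReal_natCast]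
  rw [← hval, ← integral_sub hlev hint, abs_of_nonneg]
  · have h1 : ∫ t, ((lev (pointSet t) r hr i : ℝ) - h t) ≤
        ∫ t, (sparseEvent M n).indicator (fun _ => (n : ℝ)) t := by
      refine integral_mono_ae (hlev.sub hint) hsparse ?_
      filter_upwards [ae_injective n, ae_generic n r] with t ht hgen
      by_cases hs : t ∈ sparseEvent M n
      · rw [Set.indicator_of_mem hs]
        have h2 : (lev (pointSet t) r hr i : ℝ) ≤ n := by exact_mod_cast lev_le n r hr i t
        have h3 : 0 ≤ h t := by rw [hcard]; positivity
        linarith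
      · rw [Set.indicator_of_notMem hs, sub_nonpos, hcard]
        exact_mod_cast lev_le_card_markedEvent hr hr1 hε hq ht hgen hM hMε hs
    refine h1.trans ?_
    rw [integral_indicator_const _ (measurableSet_sparseEvent M n), smul_eq_mul, mul_comm]
    gcongr
  · refine integral_nonneg_of_ae ?_
    filter_upwards [ae_injective n] with t ht
    rw [Pi.zero_apply, sub_nonneg, hcard]
    exact_mod_cast card_markedEvent_le_lev hr hr1 hε hq ht

theorem tendsto_integral_lev_div (hr : 0 < r) (hr1 : r ≤ 1) (hq : IsDenom r i q) :
    Tendsto (fun n : ℕ => (∫ t : Fin n → UnitAddCircle, (lev (pointSet t) r hr i : ℝ)) / n) atTop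
      (𝓝 (∫ u in coneKq i q, Real.exp (-l1Norm u))) := by
  obtain ⟨ε, hε⟩ := exists_isSep r i
  obtain ⟨M, hM, hMε⟩ : ∃ M : ℕ, 0 < M ∧ (2 * (i + 1) : ℝ) * (2 / M) < ε := by
    have h : Tendsto (fun M : ℕ => (2 * (i + 1) : ℝ) * (2 / M)) atTop (𝓝 0) := by
      simpa using (tendsto_const_div_atTop_nhds_zero_nat (2 : ℝ)).const_mul (2 * (i + 1) : ℝ)
    exact ((eventually_gt_atTop 0).and (h.eventually_lt_const hε.pos)).exists
  have hM' : (0 : ℝ) < M := by exact_mod_cast hM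
  have hmain := tendsto_descFactorial_mul_integral (i := i) (q := q) hε.pos hε.lt_one
  have hsmall : Tendsto (fun n : ℕ => (M : ℝ) * (1 - 1 / M) ^ n) atTop (𝓝 0) := by
    have h1 : (1 : ℝ) / M ≤ 1 := by
      rw [div_le_one hM']
      exact_mod_cast hM
    have h2 : (0 : ℝ) < 1 / M := by positivity
    simpa using (tendsto_pow_atTop_nhds_zero_of_lt_one (by linarith) (by linarith :
      1 - 1 / (M : ℝ) < 1)).const_mul (M : ℝ)
  have hdiff : Tendsto (fun n : ℕ =>
      (∫ t : Fin n → UnitAddCircle, (lev (pointSet t) r hr i : ℝ)) / n -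
        (n.descFactorial (2 * i + 3) : ℝ) / n *
          ∫ u in smallCone i q ε, (1 - l1Norm u) ^ (n - (2 * i + 3))) atTop (𝓝 0) := by
    refine squeeze_zero_norm' ?_ hsmall
    filter_upwards [eventually_gt_atTop 0] with n h0
    have hn' : (0 : ℝ) < n := by exact_mod_cast h0
    rw [Real.norm_eq_abs, div_mul_eq_mul_div, ← sub_div, abs_div, abs_of_pos hn',
      div_le_iff₀ hn', mul_comm _ (n : ℝ)]
    exact abs_integral_lev_sub_le hr hr1 hε hq hM hMε n
  simpa using hdiff.add hmain

/-- No positive multiple of `r` is an integer, so any value beyond i+1 serves as q; with i+2 the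
extra inequalities of K_i(q) are vacuous. -/
theorem isDenom_of_irrational (hr : Irrational r) (i : ℕ) : IsDenom r i (i + 2) where
  pos := by omega
  le_of_int d hd _ m hm := by
    have h := hr.natCast_mul (show d ≠ 0 by omega)
    exact absurd hm (h.ne_int m)
  int h := by omega

theorem isDenom_of_eq_div {p : ℕ} (hq : 0 < q) (hpq : Nat.Coprime p q) (hr : r = (p : ℝ) / q)
    (i : ℕ) : IsDenom r i q where
  pos := hq
  le_of_int d hd _ m hm := by
    have hq' : (q : ℝ) ≠ 0 := by exact_mod_cast hq.ne'
    rw [hr, mul_div_assoc', div_eq_iff hq'] at hm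
    have h : (d : ℤ) * p = m * q := by exact_mod_cast hm
    have hdvd : (q : ℤ) ∣ (d * p : ℕ) := ⟨m, by push_cast; rw [h]; ring⟩
    exact Nat.le_of_dvd hd (hpq.symm.dvd_of_dvd_mul_right (Int.natCast_dvd_natCast.1 hdvd))
  int _ := ⟨p, by
    have hq' : (q : ℝ) ≠ 0 := by exact_mod_cast hq.ne'
    rw [hr]
    push_cast
    field_simp⟩

theorem coneKq_add_two (i : ℕ) : coneKq i (i + 2) = coneK i := by
  ext u
  refine ⟨fun h => h.1, fun h => ⟨h, fun j k hj hjk hk => ?_⟩⟩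
  omega

end Asymptotics

theorem proposition3p3
    (r : ℝ) (hr : 0 < r) (hr1 : r ≤ 1) (i : ℕ)
    (Ω : ℕ → Type*) [∀ n, MeasurableSpace (Ω n)]
    (P : ∀ n, Measure (Ω n)) [∀ n, IsProbabilityMeasure (P n)]
    (X : ∀ n, Fin n → Ω n → UnitAddCircle)
    (hlaw : ∀ n k, HasLaw (X n k) (volume : Measure UnitAddCircle) (P n))
    (hindep : ∀ n, iIndepFun (X n) (P n)) :
    (∀ n, Integrable (fun ω => (lev (sampleSet (X n) ω) r hr i : ℝ)) (P n)) ∧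
    (Irrational r →
      Tendsto (fun n : ℕ => (∫ ω, (lev (sampleSet (X n) ω) r hr i : ℝ) ∂(P n)) / n) atTop
        (𝓝 (∫ u in coneK i, Real.exp (-l1Norm u)))) ∧
    (∀ p q : ℕ, 0 < q → Nat.Coprime p q → r = (p : ℝ) / q →
      Tendsto (fun n : ℕ => (∫ ω, (lev (sampleSet (X n) ω) r hr i : ℝ) ∂(P n)) / n) atTop
        (𝓝 (∫ u in coneKq i q, Real.exp (-l1Norm u)))) := by
  -- Independence and uniform marginals identify the joint law with Haar measure on the torus, where
  -- all the estimates live.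
  have hmap : ∀ n, (P n).map (fun ω k => X n k ω) = volume := fun n => by
    rw [(iIndepFun_iff_map_fun_eq_pi_map fun k => (hlaw n k).aemeasurable).1 (hindep n), volume_pi]
    simp_rw [(hlaw n _).map_eq]
  have hmeas : ∀ n, AEMeasurable (fun ω k => X n k ω) (P n) := fun n =>
    aemeasurable_pi_lambda _ fun k => (hlaw n k).aemeasurable
  have hint : ∀ n, Integrable (fun t : Fin n → UnitAddCircle => (lev (pointSet t) r hr i : ℝ))
      ((P n).map (fun ω k => X n k ω)) := fun n => by
    rw [hmap]
    exact integrable_lev n r hr i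
  have hexp : ∀ n, ∫ ω, (lev (sampleSet (X n) ω) r hr i : ℝ) ∂(P n) =
      ∫ t : Fin n → UnitAddCircle, (lev (pointSet t) r hr i : ℝ) := fun n => by
    rw [← hmap n, integral_map (hmeas n) (hint n).aestronglyMeasurable]
    rfl
  refine ⟨fun n => (hint n).comp_aemeasurable (hmeas n), fun hirr => ?_, fun p q hq hpq hrpq => ?_⟩
  · simp_rw [hexp, ← coneKq_add_two]
    exact tendsto_integral_lev_div hr hr1 (isDenom_of_irrational hirr i)
  · simp_rw [hexp]
    exact tendsto_integral_lev_div hr hr1 (isDenom_of_eq_div hq hpq hrpq i)
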